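/- Let $M_{\kappa,\mu}(z)=e^{-z/2}z^{1/2+\mu}\sum_{n\ge 0}\frac{(1/2+\mu-\kappa)_n}{(1+2\mu)_n\,n!}z^n$ denote the Whittaker function and $M'_{\kappa,\mu}$ its derivative with respect to $z$. Put $\gamma_0=\Gamma_0=0$ and, for $m\ge 1$, let $\gamma_{2m-1}$, $\gamma_{2m}$ be the $m$-th positive root $r$ of $M'_{-i,1/2}(ir)$ and of $M_{-i,1/2}(ir)$ respectively, and let $\Gamma_{2m-1}$, $\Gamma_{2m}$ be the $m$-th positive root $r$ of $M'_{i,1/2}(ir)$ and of $M_{i,1/2}(ir)$ respectively. For $E\in\{1,-1\}$ and $\gamma>0$ consider real functions $w$ that are continuous on $[0,\gamma]$, satisfy $w(0)=1$, and are twice differentiable on $(0,\gamma]$ with $$\ddot w+\Big(\frac14+\frac{E}{r}\Big)w=0\quad\text{on }(0,\gamma].$$ The *odd* boundary value problem asks in addition that $\dot w(\gamma)=0$, the *even* one that $w(\gamma)=0$ (derivatives at $\gamma$ are one-sided). **Lemma.** Let $\gamma>0$ and let $k,j\ge 1$ be integers with $\gamma\in[\gamma_{k-1},\gamma_k)\cap[\Gamma_{j-1},\Gamma_j)$.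 1. For $E=1$: every solution of the odd problem has exactly $\lfloor \frac k2+1\rfloor$ critical points in $(0,\gamma]$, and every solution of the even problem has exactly $\lfloor\frac k2+\frac12\rfloor$ critical points in $(0,\gamma]$. The odd problem has one and only one solution, unless $k$ is even and $\gamma=\gamma_{k-1}$; the even problem has one and only one solution, unless $k$ is odd and $\gamma=\gamma_{k-1}$. 2. For $E=-1$: every solution of the odd problem has exactly $\lfloor\frac j2\rfloor$ roots in $[0,\gamma]$, and every solution of the even problem has exactly $\lfloor\frac j2+\frac12\rfloor$ roots in $[0,\gamma]$. The odd problem has one and only one solution, unless $j$ is even and $\gamma=\Gamma_{j-1}$; the even problem has one and only one solution, unless $j$ is odd and $\gamma=\Gamma_{j-1}$. -/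

import Mathlib

open Set

noncomputable section

/-- Kummer's confluent hypergeometric function `M(a, b, z) = ∑ (a)ₙ / ((b)ₙ n!) zⁿ`. -/
def kummerM (a b z : ℂ) : ℂ :=
  ∑' n : ℕ, (ascPochhammer ℂ n).eval a / ((ascPochhammer ℂ n).eval b * (n.factorial : ℂ)) * z ^ n

/-- The Whittaker function
`M_{κ,μ}(z) = e^{-z/2} z^{1/2+μ} M(1/2+μ-κ, 1+2μ, z)` (principal branch of the power). -/
def whittakerM (κ μ z : ℂ) : ℂ :=
  Complex.exp (-z / 2) * z ^ (1 / 2 + μ) * kummerM (1 / 2 + μ - κ) (1 + 2 * μ) z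

/-- The `n`-th positive root (`n ≥ 1`) of a function `g` of a real variable: the number `x > 0`
with `g x = 0` such that `g` has exactly `n` roots in `(0, x]`. There is at most one such `x`,
so the infimum just selects it. -/
def nthPosRoot (g : ℝ → ℂ) (n : ℕ) : ℝ :=
  sInf {x : ℝ | 0 < x ∧ g x = 0 ∧ {t : ℝ | t ∈ Ioc 0 x ∧ g t = 0}.encard = (n : ℕ∞)}

/-- The sequence `0`, first positive root of `r ↦ M'_{κ,1/2}(ir)`, first positive root of
`r ↦ M_{κ,1/2}(ir)`, second positive root of `r ↦ M'_{κ,1/2}(ir)`, and so on; the prime is the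
complex derivative with respect to the argument of the Whittaker function. -/
def whittakerSeq (κ : ℂ) (n : ℕ) : ℝ :=
  if n = 0 then 0
  else if Even n then
    nthPosRoot (fun r : ℝ => whittakerM κ (1 / 2) (Complex.I * (r : ℂ))) (n / 2)
  else
    nthPosRoot (fun r : ℝ => deriv (whittakerM κ (1 / 2)) (Complex.I * (r : ℂ))) ((n + 1) / 2)

/-- The numbers `γ_k`, belonging to `κ = -i` (that is, to `E = 1`). -/
def gammaSeq (k : ℕ) : ℝ := whittakerSeq (-Complex.I) k

/-- The numbers `Γ_j`, belonging to `κ = i` (that is, to `E = -1`). -/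
def GammaSeq (j : ℕ) : ℝ := whittakerSeq Complex.I j

/-- The derivative of `w` on `(0, γ]` (one-sided at the right end point). -/
def dotOn (γ : ℝ) (w : ℝ → ℝ) : ℝ → ℝ := derivWithin w (Ioc 0 γ)

/-- `w` is continuous on `[0, γ]`, is twice differentiable on `(0, γ]` with
`w'' + (1/4 + E/r) w = 0` there, and `w(0) = 1`. -/
structure IsNormalizedSolution (E γ : ℝ) (w : ℝ → ℝ) : Prop where
  continuousOn : ContinuousOn w (Icc 0 γ)
  differentiableOn : DifferentiableOn ℝ w (Ioc 0 γ)
  differentiableOn_dot : DifferentiableOn ℝ (dotOn γ w) (Ioc 0 γ)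
  equation : ∀ r ∈ Ioc 0 γ, dotOn γ (dotOn γ w) r + (1 / 4 + E / r) * w r = 0
  left_bc : w 0 = 1

/-- The odd boundary value problem
`w'' + (1/4 + E/r) w = 0` on `(0, γ]`, `w(0) = 1`, `w'(γ) = 0`. -/
def SolvesOddBVP (E γ : ℝ) (w : ℝ → ℝ) : Prop :=
  IsNormalizedSolution E γ w ∧ dotOn γ w γ = 0

/-- The even boundary value problem
`w'' + (1/4 + E/r) w = 0` on `(0, γ]`, `w(0) = 1`, `w(γ) = 0`. -/
def SolvesEvenBVP (E γ : ℝ) (w : ℝ → ℝ) : Prop :=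
  IsNormalizedSolution E γ w ∧ w γ = 0

/-- Critical points of `w` in `(0, γ]`. -/
def criticalPoints (γ : ℝ) (w : ℝ → ℝ) : Set ℝ := {r : ℝ | r ∈ Ioc 0 γ ∧ dotOn γ w r = 0}

/-- Roots of `w` in `[0, γ]`. -/
def roots (γ : ℝ) (w : ℝ → ℝ) : Set ℝ := {r : ℝ | r ∈ Icc 0 γ ∧ w r = 0}

/-- A boundary value problem, given as a predicate on functions, has one and only one solution
on `[0, γ]` (values outside `[0, γ]` are disregarded). -/
def HasUniqueSolution (γ : ℝ) (P : (ℝ → ℝ) → Prop) : Prop :=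
  ∃ w : ℝ → ℝ, P w ∧ ∀ v : ℝ → ℝ, P v → EqOn v w (Icc 0 γ)

end

/-! At `0` the equation `r w'' + (r/4 + E) w = 0` has exponents `1` and `0`: a regular solution `φ`
with `φ(0) = 0`, `φ'(0) = 1`, and a logarithmic one `u` with `u(0) = 1`. The normalized solutions
are exactly `u + βφ`, so each boundary condition is one linear equation for `β`, with coefficient
`φ'(γ)` (odd) or `φ(γ)` (even). Since `M_{-iE,1/2}(ir) = iφ(r)` and `M'_{-iE,1/2}(ir) = φ'(r)`
(`whittakerM_half_I_mul`), the given sequences list zeros of `φ'` and `φ` alternately, and the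
position of `γ` fixes how many of each lie in `(0, γ]` (`encard_zeros_of_mem_Ico`).

Every normalized solution forms with `φ` a pair of Wronskian `-1`, so Sturm interlacing compares its
zeros and critical points with those of `φ` and `φ'`. For derivatives this requires `q = 1/4 + E/r >
0`. That is automatic for `E = 1`; for `E = -1` it holds to the right of any zero of `φ'`, as such
zeros exceed `4`. The behavior at the ends decides the exact counts: for `E = 1`, `u' → +∞` at `0`
forces an initial critical point; for `E = -1` in the odd problem, the sign of `φφ'` at `γ` decides.
Interlacing is used through inequalities between extended cardinalities, so discreteness of zero
sets is not needed beforehand. -/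

open Filter Topology

/-! ### Power series with factorially decaying coefficients -/

/-- Coefficients of an entire function of exponential type. -/
def ExpBounded {𝕜 : Type*} [RCLike 𝕜] (c : ℕ → 𝕜) : Prop :=
  ∃ C A : ℝ, 0 ≤ C ∧ 0 ≤ A ∧ ∀ n, ‖c n‖ ≤ C * A ^ n / (n.factorial : ℝ)

/-- The sum of the power series with coefficients `c`. -/
noncomputable def powSum {𝕜 : Type*} [RCLike 𝕜] (c : ℕ → 𝕜) (z : 𝕜) : 𝕜 := ∑' n, c n * z ^ n

/-- The coefficients of the derivative of a power series. -/
def derivCoeff {𝕜 : Type*} [RCLike 𝕜] (c : ℕ → 𝕜) (n : ℕ) : 𝕜 := ((n : 𝕜) + 1) * c (n + 1)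

namespace ExpBounded

variable {𝕜 : Type*} [RCLike 𝕜] {c d : ℕ → 𝕜}

theorem shift (hc : ExpBounded c) : ExpBounded fun n => c (n + 1) := by
  obtain ⟨C, A, hC, hA, h⟩ := hc
  refine ⟨C * A, A, by positivity, hA, fun n => (h (n + 1)).trans ?_⟩
  rw [show C * A ^ (n + 1) = C * A * A ^ n by ring]
  refine div_le_div_of_nonneg_left (by positivity) (by positivity) ?_
  exact_mod_cast Nat.factorial_le n.le_succ

theorem derivCoeff (hc : ExpBounded c) : ExpBounded (derivCoeff c) := by
  obtain ⟨C, A, hC, hA, h⟩ := hc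
  refine ⟨C * A, A, by positivity, hA, fun n => ?_⟩
  have h1 : ‖((n : 𝕜) + 1)‖ = (n : ℝ) + 1 := by
    rw [← Nat.cast_succ, RCLike.norm_natCast, Nat.cast_succ]
  rw [_root_.derivCoeff, norm_mul, h1]
  refine (mul_le_mul_of_nonneg_left (h (n + 1)) (by positivity)).trans (le_of_eq ?_)
  rw [Nat.factorial_succ, pow_succ]
  push_cast
  field_simp

theorem norm_summable (hc : ExpBounded c) (R : ℝ) (hR : 0 ≤ R) :
    Summable fun n => ‖c n‖ * R ^ n := by
  obtain ⟨C, A, hC, hA, h⟩ := hc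
  refine Summable.of_nonneg_of_le (fun n => by positivity) (fun n => ?_)
    ((Real.summable_pow_div_factorial (A * R)).mul_left C)
  refine (mul_le_mul_of_nonneg_right (h n) (by positivity)).trans (le_of_eq ?_)
  rw [mul_pow]
  ring

theorem summable (hc : ExpBounded c) (z : 𝕜) : Summable fun n => c n * z ^ n := by
  refine Summable.of_norm ?_
  simpa using hc.norm_summable ‖z‖ (norm_nonneg _)

theorem powSum_eq_add (hc : ExpBounded c) (z : 𝕜) :
    powSum c z = c 0 + z * powSum (fun n => c (n + 1)) z := by
  rw [powSum, (hc.summable z).tsum_eq_zero_add, powSum, ← tsum_mul_left]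
  simp only [pow_zero, mul_one]
  congr 1
  exact tsum_congr fun n => by ring

theorem powSum_zero (hc : ExpBounded c) : powSum c 0 = c 0 := by
  rw [hc.powSum_eq_add, zero_mul, add_zero]

theorem hasDerivAt (hc : ExpBounded c) (z : 𝕜) :
    HasDerivAt (powSum c) (powSum (_root_.derivCoeff c) z) z := by
  have hd := hc.derivCoeff
  have hR : 0 ≤ ‖z‖ + 1 := by positivity
  have hu : Summable fun n : ℕ => (n : ℝ) * ‖c n‖ * (‖z‖ + 1) ^ (n - 1) := by
    rw [← summable_nat_add_iff 1]
    refine (hd.norm_summable (‖z‖ + 1) hR).congr fun n => ?_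
    have h1 : ‖((n : 𝕜) + 1)‖ = (n : ℝ) + 1 := by
      rw [← Nat.cast_succ, RCLike.norm_natCast, Nat.cast_succ]
    rw [_root_.derivCoeff, norm_mul, h1]
    simp
  -- Termwise differentiation on a ball of radius `‖z‖ + 1`, where the differentiated series has a
  -- summable majorant.
  have key := hasDerivAt_tsum_of_isPreconnected (𝕜 := 𝕜) (g := fun n y => c n * y ^ n)
    (g' := fun n y => c n * (n * y ^ (n - 1))) (t := Metric.ball 0 (‖z‖ + 1)) (y₀ := z) (y := z)
    hu Metric.isOpen_ball (convex_ball (0 : 𝕜) (‖z‖ + 1)).isPreconnected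
    (fun n y _ => (hasDerivAt_pow n y).const_mul _) (fun n y hy => ?_) (by simp)
    (hc.summable z) (by simp)
  · have h2 : (∑' n : ℕ, c n * ((n : 𝕜) * z ^ (n - 1))) = powSum (_root_.derivCoeff c) z := by
      have hs : Summable fun n : ℕ => c n * ((n : 𝕜) * z ^ (n - 1)) := by
        rw [← summable_nat_add_iff 1]
        refine (hd.summable z).congr fun n => ?_
        simp [_root_.derivCoeff]
        ring
      rw [hs.tsum_eq_zero_add, powSum]
      simp [_root_.derivCoeff]
      exact tsum_congr fun n => by ring
    rw [← h2]
    exact key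
  · have hy' : ‖y‖ ≤ ‖z‖ + 1 := by simpa using (mem_ball_zero_iff.mp hy).le
    rw [norm_mul, norm_mul, norm_pow, RCLike.norm_natCast]
    calc ‖c n‖ * (n * ‖y‖ ^ (n - 1)) = n * ‖c n‖ * ‖y‖ ^ (n - 1) := by ring
      _ ≤ _ := by gcongr

theorem continuous (hc : ExpBounded c) : Continuous (powSum c) :=
  continuous_iff_continuousAt.mpr fun z => (hc.hasDerivAt z).continuousAt

end ExpBounded

/-! ### Frobenius series at the singular point -/

/-- Coefficients of the regular solution of `r φ'' + (r / 4 + E) φ = 0`. -/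
noncomputable def regCoeff (E : ℝ) : ℕ → ℝ
  | 0 => 0
  | 1 => 1
  | n + 2 => -(E * regCoeff E (n + 1) + regCoeff E n / 4) / (((n : ℝ) + 1) * (n + 2))

/-- Coefficients of the power series part of the logarithmic solution of
`r ψ'' + (r / 4 + E) ψ = 0`. -/
noncomputable def logCoeff (E : ℝ) : ℕ → ℝ
  | 0 => 1
  | 1 => 0
  | n + 2 => (E * ((2 * n + 3) * regCoeff E (n + 2)) - (E * logCoeff E (n + 1) + logCoeff E n / 4))
      / (((n : ℝ) + 1) * (n + 2))

theorem abs_regCoeff_le {E : ℝ} (hE : |E| ≤ 1) :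
    ∀ n, |regCoeff E n| ≤ 2 ^ n / (n.factorial : ℝ)
  | 0 => by simp [regCoeff]
  | 1 => by simp [regCoeff]
  | n + 2 => by
    have h0 := abs_regCoeff_le hE n
    have h1 := abs_regCoeff_le hE (n + 1)
    have hn : (0 : ℝ) ≤ n := n.cast_nonneg
    have hf : (0 : ℝ) < n.factorial := by positivity
    rw [regCoeff, abs_div, abs_neg, abs_of_pos (a := ((n : ℝ) + 1) * (n + 2)) (by positivity),
      div_le_iff₀ (by positivity)]
    have h2 : |E * regCoeff E (n + 1) + regCoeff E n / 4|
        ≤ |regCoeff E (n + 1)| + |regCoeff E n| / 4 := by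
      refine (abs_add_le _ _).trans ?_
      rw [abs_mul, abs_div, abs_of_pos (a := (4 : ℝ)) (by norm_num)]
      nlinarith [abs_nonneg (regCoeff E (n + 1))]
    refine h2.trans ((add_le_add h1 (div_le_div_of_nonneg_right h0 (by norm_num))).trans ?_)
    rw [Nat.factorial_succ (n + 1), Nat.factorial_succ n]
    push_cast
    have e : (2 : ℝ) ^ (n + 2) / (((n : ℝ) + 1 + 1) * (((n : ℝ) + 1) * n.factorial))
        * (((n : ℝ) + 1) * (n + 2)) = 4 * (2 ^ n / n.factorial) := by
      field_simp
      ring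
    have e1 : (2 : ℝ) ^ (n + 1) / (((n : ℝ) + 1) * n.factorial) ≤ 2 * (2 ^ n / n.factorial) := by
      rw [pow_succ, mul_comm ((2 : ℝ) ^ n), mul_div_assoc]
      gcongr
      nlinarith
    rw [e]
    have : (0 : ℝ) < 2 ^ n / n.factorial := by positivity
    linarith

theorem expBounded_regCoeff {E : ℝ} (hE : |E| ≤ 1) : ExpBounded (regCoeff E) :=
  ⟨1, 2, by norm_num, by norm_num, fun n => by simpa using abs_regCoeff_le hE n⟩

/-- In units of `4 ^ n / n!`, the source term contributes at most `16` and the two earlier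
coefficients at most `12` and `3/4`, against an allowance of `48`. -/
theorem abs_logCoeff_le {E : ℝ} (hE : |E| ≤ 1) :
    ∀ n, |logCoeff E n| ≤ 3 * (4 ^ n / (n.factorial : ℝ))
  | 0 => by simp [logCoeff]
  | 1 => by simp [logCoeff]
  | n + 2 => by
    have h0 := abs_logCoeff_le hE n
    have h1 := abs_logCoeff_le hE (n + 1)
    have ha := abs_regCoeff_le hE (n + 2)
    have hn : (0 : ℝ) ≤ n := n.cast_nonneg
    have hf : (0 : ℝ) < n.factorial := by positivity
    rw [logCoeff, abs_div, abs_of_pos (a := ((n : ℝ) + 1) * (n + 2)) (by positivity),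
      div_le_iff₀ (by positivity)]
    have h2 : |E * ((2 * n + 3) * regCoeff E (n + 2)) - (E * logCoeff E (n + 1) + logCoeff E n / 4)|
        ≤ (2 * n + 3) * |regCoeff E (n + 2)| + (|logCoeff E (n + 1)| + |logCoeff E n| / 4) := by
      refine (abs_sub _ _).trans (add_le_add ?_ ((abs_add_le _ _).trans (add_le_add ?_ ?_)))
      · rw [abs_mul, abs_mul, abs_of_pos (a := 2 * (n : ℝ) + 3) (by positivity)]
        exact mul_le_of_le_one_left (by positivity) hE
      · rw [abs_mul]
        exact mul_le_of_le_one_left (by positivity) hE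
      · rw [abs_div, abs_of_pos (a := (4 : ℝ)) (by norm_num)]
    refine h2.trans ((add_le_add (mul_le_mul_of_nonneg_left ha (by positivity))
      (add_le_add h1 (div_le_div_of_nonneg_right h0 (by norm_num)))).trans ?_)
    rw [Nat.factorial_succ (n + 1), Nat.factorial_succ n]
    push_cast
    have e : 3 * ((4 : ℝ) ^ (n + 2) / (((n : ℝ) + 1 + 1) * (((n : ℝ) + 1) * n.factorial)))
        * (((n : ℝ) + 1) * (n + 2)) = 48 * (4 ^ n / n.factorial) := by
      field_simp
      ring
    have e1 : (4 : ℝ) ^ (n + 1) / (((n : ℝ) + 1) * n.factorial) ≤ 4 * (4 ^ n / n.factorial) := by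
      rw [pow_succ, mul_comm ((4 : ℝ) ^ n), mul_div_assoc]
      gcongr
      nlinarith
    have e2 : (2 * (n : ℝ) + 3) * (2 ^ (n + 2) / (((n : ℝ) + 1 + 1) * (((n : ℝ) + 1) * n.factorial)))
        ≤ 16 * (4 ^ n / n.factorial) := by
      have e3 : (2 * (n : ℝ) + 3) * (2 ^ (n + 2) / (((n : ℝ) + 1 + 1) * (((n : ℝ) + 1) * n.factorial)))
          = ((2 * (n : ℝ) + 3) / (((n : ℝ) + 2) * ((n : ℝ) + 1))) * (4 * (2 ^ n / n.factorial)) := by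
        field_simp
        ring
      have e4 : (2 * (n : ℝ) + 3) / (((n : ℝ) + 2) * ((n : ℝ) + 1)) ≤ 4 := by
        rw [div_le_iff₀ (by positivity)]
        nlinarith
      have e5 : (2 : ℝ) ^ n / n.factorial ≤ 4 ^ n / n.factorial := by
        gcongr
        norm_num
      rw [e3]
      calc _ ≤ 4 * (4 * ((2 : ℝ) ^ n / n.factorial)) := by gcongr
        _ ≤ _ := by linarith
    rw [e]
    have : (0 : ℝ) < 4 ^ n / n.factorial := by positivity
    linarith

theorem expBounded_logCoeff {E : ℝ} (hE : |E| ≤ 1) : ExpBounded (logCoeff E) :=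
  ⟨3, 4, by norm_num, by norm_num, fun n => by
    simpa [mul_div_assoc] using abs_logCoeff_le hE n⟩

theorem powSum_regCoeff_equation {E : ℝ} (hE : |E| ≤ 1) (r : ℝ) :
    r * powSum (derivCoeff (derivCoeff (regCoeff E))) r
      + (r / 4 + E) * powSum (regCoeff E) r = 0 := by
  have hc := expBounded_regCoeff hE
  rw [add_mul, hc.powSum_eq_add r]
  simp only [regCoeff, zero_add]
  have h1 : powSum (derivCoeff (derivCoeff (regCoeff E))) r
      + powSum (regCoeff E) r / 4 + E * powSum (fun n => regCoeff E (n + 1)) r = 0 := by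
    simp only [powSum]
    rw [← tsum_div_const, ← tsum_mul_left, ← Summable.tsum_add
      (hc.derivCoeff.derivCoeff.summable r) ((hc.summable r).div_const 4),
      ← Summable.tsum_add ((hc.derivCoeff.derivCoeff.summable r).add ((hc.summable r).div_const 4))
      ((hc.shift.summable r).mul_left E)]
    refine (tsum_congr fun n => ?_).trans tsum_zero
    simp only [derivCoeff, regCoeff]
    push_cast
    field_simp
    ring
  have h2 := hc.powSum_eq_add r
  simp only [regCoeff, zero_add] at h2
  rw [h2] at h1
  linear_combination r * h1

/-- Substituting `-E φ log r + ψ` into the equation, the logarithms cancel because `φ` is a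
solution; what remains is this inhomogeneous equation for `ψ`, with `φ / r` written as a shifted
series. -/
theorem powSum_logCoeff_equation {E : ℝ} (hE : |E| ≤ 1) (r : ℝ) :
    r * powSum (derivCoeff (derivCoeff (logCoeff E))) r + (r / 4 + E) * powSum (logCoeff E) r
      = E * (2 * powSum (derivCoeff (regCoeff E)) r - powSum (fun n => regCoeff E (n + 1)) r) := by
  have hc := expBounded_regCoeff hE
  have hb := expBounded_logCoeff hE
  have e1 := hb.powSum_eq_add r
  have e2 := hc.derivCoeff.powSum_eq_add r
  have e3 := hc.shift.powSum_eq_add r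
  have e4 : powSum (derivCoeff (derivCoeff (logCoeff E))) r
      + powSum (logCoeff E) r / 4 + E * powSum (fun n => logCoeff E (n + 1)) r
      = E * (2 * powSum (fun n => derivCoeff (regCoeff E) (n + 1)) r
        - powSum (fun n => regCoeff E (n + 1 + 1)) r) := by
    simp only [powSum]
    rw [← tsum_div_const, ← tsum_mul_left, ← Summable.tsum_add
      (hb.derivCoeff.derivCoeff.summable r) ((hb.summable r).div_const 4),
      ← Summable.tsum_add ((hb.derivCoeff.derivCoeff.summable r).add ((hb.summable r).div_const 4))
      ((hb.shift.summable r).mul_left E), ← tsum_mul_left,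
      ← Summable.tsum_sub ((hc.derivCoeff.shift.summable r).mul_left 2)
        (hc.shift.shift.summable r), ← tsum_mul_left]
    refine tsum_congr fun n => ?_
    simp only [derivCoeff, logCoeff]
    push_cast
    field_simp
    ring
  -- The constant terms agree because `E · 1 = E (2 · 1 - 1)`; this fixes the factor `-E` of the
  -- logarithm.
  have v0 : logCoeff E 0 = 1 := rfl
  have v1 : derivCoeff (regCoeff E) 0 = 1 := by simp [derivCoeff, regCoeff]
  have v2 : regCoeff E (0 + 1) = 1 := rfl
  rw [v0] at e1
  rw [v1] at e2
  rw [v2] at e3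
  rw [e2, e3]
  rw [e1] at e4 ⊢
  linear_combination r * e4

/-! ### Wronskians and the fundamental pair -/

/-- `f` with derivative `f'` solves `f'' + q f = 0` on `s`. -/
def SolvesOn (q : ℝ → ℝ) (s : Set ℝ) (f f' : ℝ → ℝ) : Prop :=
  ∀ r ∈ s, HasDerivWithinAt f (f' r) s r ∧ HasDerivWithinAt f' (-(q r * f r)) s r

theorem SolvesOn.wronskian_eq {q f f' g g' : ℝ → ℝ} {s : Set ℝ} (hs : Convex ℝ s)
    (hf : SolvesOn q s f f') (hg : SolvesOn q s g g') {x y : ℝ} (hx : x ∈ s) (hy : y ∈ s) :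
    f' y * g y - f y * g' y = f' x * g x - f x * g' x := by
  have h := hs.norm_image_sub_le_of_norm_hasDerivWithin_le
    (f := fun r => f' r * g r - f r * g' r) (f' := fun _ => 0) (C := 0)
    (fun r hr => by
      refine (((hf r hr).2.mul (hg r hr).1).sub ((hf r hr).1.mul (hg r hr).2)).congr_deriv ?_
      ring)
    (fun _ _ => by simp) hx hy
  simpa [sub_eq_zero] using h

/-- The coefficient of the equation `w'' + (1 / 4 + E / r) w = 0`. -/
noncomputable def coulombCoeff (E r : ℝ) : ℝ := 1 / 4 + E / r

/-- `φ` is the regular solution of `w'' + (1 / 4 + E / r) w = 0` on `(0, ∞)` and `u` is a solution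
with `u(0) = 1`; `dφ` and `du` are their derivatives. -/
structure IsFundamentalPair (E : ℝ) (φ dφ u du : ℝ → ℝ) : Prop where
  reg_zero : φ 0 = 0
  dreg_zero : dφ 0 = 1
  hasDerivAt_reg : ∀ r, HasDerivAt φ (dφ r) r
  continuous_dreg : Continuous dφ
  hasDerivAt_dreg : ∀ r, 0 < r → HasDerivAt dφ (-(coulombCoeff E r * φ r)) r
  log_zero : u 0 = 1
  continuous_log : Continuous u
  hasDerivAt_log : ∀ r, 0 < r → HasDerivAt u (du r) r
  hasDerivAt_dlog : ∀ r, 0 < r → HasDerivAt du (-(coulombCoeff E r * u r)) r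
  wronskian : ∀ r, 0 < r → du r * φ r - u r * dφ r = -1
  tendsto_dlog : 0 < E → Tendsto du (𝓝[>] 0) atTop

/-- The regular solution. -/
noncomputable def regSol (E : ℝ) : ℝ → ℝ := powSum (regCoeff E)

/-- The derivative of the regular solution. -/
noncomputable def dregSol (E : ℝ) : ℝ → ℝ := powSum (derivCoeff (regCoeff E))

/-- The quotient of the regular solution by `r`. -/
noncomputable def regQuot (E : ℝ) : ℝ → ℝ := powSum fun n => regCoeff E (n + 1)

/-- A solution with a logarithmic term. -/
noncomputable def logSol (E r : ℝ) : ℝ := -E * (regSol E r * Real.log r) + powSum (logCoeff E) r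

/-- The derivative of the logarithmic solution. -/
noncomputable def dlogSol (E r : ℝ) : ℝ :=
  -E * (dregSol E r * Real.log r + regQuot E r) + powSum (derivCoeff (logCoeff E)) r

section

variable {E : ℝ} (hE : |E| ≤ 1)
include hE

theorem regSol_eq_mul (r : ℝ) : regSol E r = r * regQuot E r := by
  rw [regSol, (expBounded_regCoeff hE).powSum_eq_add, regQuot]
  simp [regCoeff]

theorem isFundamentalPair_logSol :
    IsFundamentalPair E (regSol E) (dregSol E) (logSol E) (dlogSol E) := by
  have hc := expBounded_regCoeff hE
  have hb := expBounded_logCoeff hE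
  have hφ : ∀ r, HasDerivAt (regSol E) (dregSol E r) r := hc.hasDerivAt
  have hφ0 : regSol E 0 = 0 := by rw [regSol, hc.powSum_zero, regCoeff]
  have hdφ0 : dregSol E 0 = 1 := by
    rw [dregSol, hc.derivCoeff.powSum_zero]
    simp [derivCoeff, regCoeff]
  have hdφc : Continuous (dregSol E) := hc.derivCoeff.continuous
  have hqc : Continuous (regQuot E) := hc.shift.continuous
  have hdφ : ∀ r, 0 < r → HasDerivAt (dregSol E) (-(coulombCoeff E r * regSol E r)) r := by
    intro r hr
    refine (hc.derivCoeff.hasDerivAt r).congr_deriv ?_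
    have := powSum_regCoeff_equation hE r
    rw [coulombCoeff, regSol]
    field_simp
    linarith
  have hu0 : logSol E 0 = 1 := by simp [logSol, hb.powSum_zero, logCoeff]
  have hulc : Continuous fun r => regSol E r * Real.log r := by
    have : (fun r => regSol E r * Real.log r) = fun r => regQuot E r * (r * Real.log r) := by
      funext r
      rw [regSol_eq_mul hE]
      ring
    rw [this]
    exact hqc.mul Real.continuous_mul_log
  have huc : Continuous (logSol E) := (hulc.const_mul _).add hb.continuous
  have hu : ∀ r, 0 < r → HasDerivAt (logSol E) (dlogSol E r) r := by
    intro r hr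
    refine ((((hφ r).mul (Real.hasDerivAt_log hr.ne')).const_mul (-E)).add
      (hb.hasDerivAt r)).congr_deriv ?_
    rw [dlogSol, regSol_eq_mul hE]
    field_simp
  have hq : ∀ r, 0 < r → HasDerivAt (regQuot E) (dregSol E r / r - regQuot E r / r) r := by
    intro r hr
    have h1 := (hφ r).div (hasDerivAt_id r) hr.ne'
    have h2 : regQuot E =ᶠ[𝓝 r] fun x => regSol E x / id x := by
      filter_upwards [lt_mem_nhds hr] with x hx
      rw [regSol_eq_mul hE, id, mul_div_cancel_left₀ _ hx.ne']
    refine (h1.congr_of_eventuallyEq h2).congr_deriv ?_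
    rw [regSol_eq_mul hE, id]
    field_simp
  have hdu : ∀ r, 0 < r → HasDerivAt (dlogSol E) (-(coulombCoeff E r * logSol E r)) r := by
    intro r hr
    refine (((((hdφ r hr).mul (Real.hasDerivAt_log hr.ne')).add (hq r hr)).const_mul (-E)).add
      (hb.derivCoeff.hasDerivAt r)).congr_deriv ?_
    have h3 := powSum_logCoeff_equation hE r
    have h4 : powSum (derivCoeff (derivCoeff (logCoeff E))) r
        = (E * (2 * dregSol E r - regQuot E r) - (r / 4 + E) * powSum (logCoeff E) r) / r := by
      rw [eq_div_iff hr.ne', dregSol, regQuot]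
      linarith
    rw [h4, logSol, coulombCoeff]
    field_simp
    ring
  -- The Wronskian is constant on `(0, ∞)`, so its limit at `0` determines it. There the logarithm
  -- occurs only in the product `φ log r`, which tends to `0`.
  have hwl : Tendsto (fun r => dlogSol E r * regSol E r - logSol E r * dregSol E r)
      (𝓝[>] 0) (𝓝 (-1)) := by
    have h5 : Continuous fun r => (-E * (dregSol E r * (regSol E r * Real.log r)
        + regQuot E r * regSol E r) + powSum (derivCoeff (logCoeff E)) r * regSol E r)
        - logSol E r * dregSol E r :=
      (((hdφc.mul hulc).add (hqc.mul hc.continuous)).const_mul _ |>.add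
        (hb.derivCoeff.continuous.mul hc.continuous)).sub (huc.mul hdφc)
    have h6 := h5.tendsto 0
    simp only [hφ0, hu0, hdφ0] at h6
    refine ((by simpa using h6 : Tendsto _ _ (𝓝 (-1 : ℝ))).mono_left
      nhdsWithin_le_nhds).congr fun r => ?_
    rw [dlogSol]
    ring
  refine ⟨hφ0, hdφ0, hφ, hdφc, hdφ, hu0, huc, hu, hdu, fun r hr => ?_, fun hE0 => ?_⟩
  · have hev : ∀ᶠ x in 𝓝[>] (0 : ℝ), dlogSol E x * regSol E x - logSol E x * dregSol E x
        = dlogSol E r * regSol E r - logSol E r * dregSol E r := by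
      filter_upwards [self_mem_nhdsWithin] with x hx
      exact SolvesOn.wronskian_eq (q := coulombCoeff E) (convex_Ioi 0)
        (fun y hy => ⟨(hu y hy).hasDerivWithinAt, (hdu y hy).hasDerivWithinAt⟩)
        (fun y hy => ⟨(hφ y).hasDerivWithinAt, (hdφ y hy).hasDerivWithinAt⟩)
        (Set.mem_Ioi.mpr hr) hx
    exact tendsto_nhds_unique (tendsto_const_nhds.congr' (hev.mono fun _ h => h.symm)) hwl
  -- Near `0` the derivative is `-E φ' log r` plus a bounded term.
  · have h7 : Tendsto (fun r => -E * dregSol E r) (𝓝[>] 0) (𝓝 (-E)) := by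
      have := ((hdφc.const_mul (-E)).tendsto 0).mono_left (nhdsWithin_le_nhds (s := Ioi 0))
      simpa [hdφ0] using this
    have h8 := h7.neg_mul_atBot (by linarith) Real.tendsto_log_nhdsGT_zero
    have h9 : Tendsto (fun r => -E * regQuot E r + powSum (derivCoeff (logCoeff E)) r)
        (𝓝[>] 0) (𝓝 _) :=
      (((hqc.const_mul (-E)).add hb.derivCoeff.continuous).tendsto 0).mono_left nhdsWithin_le_nhds
    refine (h8.atTop_add h9).congr fun r => ?_
    rw [dlogSol]
    ring

end

/-! ### Normalized solutions and unique solvability -/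

namespace IsFundamentalPair

variable {E γ : ℝ} {φ dφ u du : ℝ → ℝ} (h : IsFundamentalPair E φ dφ u du)
include h

theorem solvesOn_reg : SolvesOn (coulombCoeff E) (Ioc 0 γ) φ dφ := fun r hr =>
  ⟨(h.hasDerivAt_reg r).hasDerivWithinAt, (h.hasDerivAt_dreg r hr.1).hasDerivWithinAt⟩

theorem solvesOn_log : SolvesOn (coulombCoeff E) (Ioc 0 γ) u du := fun r hr =>
  ⟨(h.hasDerivAt_log r hr.1).hasDerivWithinAt, (h.hasDerivAt_dlog r hr.1).hasDerivWithinAt⟩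

theorem continuous_reg : Continuous φ :=
  continuous_iff_continuousAt.mpr fun r => (h.hasDerivAt_reg r).continuousAt

/-- A multiple of `φ` changes neither the value at `0` nor the Wronskian. Hence results on the
second member of a pair apply to every normalized solution. -/
theorem add_mul_reg (c : ℝ) :
    IsFundamentalPair E φ dφ (fun r => u r + c * φ r) (fun r => du r + c * dφ r) where
  reg_zero := h.reg_zero
  dreg_zero := h.dreg_zero
  hasDerivAt_reg := h.hasDerivAt_reg
  continuous_dreg := h.continuous_dreg
  hasDerivAt_dreg := h.hasDerivAt_dreg
  log_zero := by simp [h.log_zero, h.reg_zero]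
  continuous_log := h.continuous_log.add (h.continuous_reg.const_mul c)
  hasDerivAt_log r hr := (h.hasDerivAt_log r hr).add ((h.hasDerivAt_reg r).const_mul c)
  hasDerivAt_dlog r hr := ((h.hasDerivAt_dlog r hr).add
    ((h.hasDerivAt_dreg r hr).const_mul c)).congr_deriv (by ring)
  wronskian r hr := by linear_combination h.wronskian r hr
  tendsto_dlog hE := (h.tendsto_dlog hE).atTop_add
    (((h.continuous_dreg.const_mul c).tendsto 0).mono_left nhdsWithin_le_nhds)

/-- Every solution on `(0, γ]` is a linear combination of the two fundamental ones. -/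
theorem exists_eq_add {v v' : ℝ → ℝ} (hγ : 0 < γ)
    (hv : SolvesOn (coulombCoeff E) (Ioc 0 γ) v v') :
    ∃ α β : ℝ, ∀ r ∈ Ioc 0 γ, v r = α * u r + β * φ r ∧ v' r = α * du r + β * dφ r := by
  have hm : γ ∈ Ioc 0 γ := ⟨hγ, le_rfl⟩
  -- Cramer's rule: the coefficients are Wronskians of `v` with `φ` and `u`, constant and evaluated
  -- at `γ`.
  refine ⟨-(v' γ * φ γ - v γ * dφ γ), v' γ * u γ - v γ * du γ, fun r hr => ?_⟩
  have e1 := hv.wronskian_eq (convex_Ioc 0 γ) h.solvesOn_reg hm hr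
  have e2 := hv.wronskian_eq (convex_Ioc 0 γ) h.solvesOn_log hm hr
  have e3 := h.wronskian r hr.1
  constructor
  · linear_combination -u r * e1 + φ r * e2 + v r * e3
  · linear_combination -du r * e1 + dφ r * e2 + v' r * e3

/-- A solution that is continuous at `0` with value `a`. -/
theorem exists_eq_of_tendsto {v v' : ℝ → ℝ} {a : ℝ} (hγ : 0 < γ)
    (hv : SolvesOn (coulombCoeff E) (Ioc 0 γ) v v') (ha : Tendsto v (𝓝[>] 0) (𝓝 a)) :
    ∃ β : ℝ, ∀ r ∈ Ioc 0 γ, v r = a * u r + β * φ r ∧ v' r = a * du r + β * dφ r := by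
  obtain ⟨α, β, hαβ⟩ := h.exists_eq_add hγ hv
  have h1 : Tendsto (fun r => α * u r + β * φ r) (𝓝[>] 0) (𝓝 α) := by
    have hc : Continuous fun r => α * u r + β * φ r :=
      (h.continuous_log.const_mul α).add (h.continuous_reg.const_mul β)
    simpa [h.log_zero, h.reg_zero] using (hc.tendsto 0).mono_left (nhdsWithin_le_nhds (s := Ioi 0))
  have h2 : v =ᶠ[𝓝[>] 0] fun r => α * u r + β * φ r := by
    filter_upwards [Ioc_mem_nhdsGT hγ] with r hr using (hαβ r hr).1
  obtain rfl := tendsto_nhds_unique (ha.congr' h2) h1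
  exact ⟨β, hαβ⟩

theorem exists_eq_of_isNormalizedSolution {w : ℝ → ℝ} (hγ : 0 < γ)
    (hw : IsNormalizedSolution E γ w) :
    ∃ β : ℝ, ∀ r ∈ Ioc 0 γ, w r = u r + β * φ r ∧ dotOn γ w r = du r + β * dφ r := by
  have hv : SolvesOn (coulombCoeff E) (Ioc 0 γ) w (dotOn γ w) := by
    intro r hr
    refine ⟨(hw.differentiableOn r hr).hasDerivWithinAt, ?_⟩
    refine (hw.differentiableOn_dot r hr).hasDerivWithinAt.congr_deriv ?_
    have := hw.equation r hr
    rw [coulombCoeff]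
    exact eq_neg_of_add_eq_zero_left this
  have ha : Tendsto w (𝓝[>] 0) (𝓝 1) := by
    have := (hw.continuousOn 0 ⟨le_rfl, hγ.le⟩).tendsto
    rw [hw.left_bc] at this
    refine this.mono_left ?_
    rw [← nhdsWithin_Ioc_eq_nhdsGT hγ]
    exact nhdsWithin_mono _ Ioc_subset_Icc_self
  simpa using h.exists_eq_of_tendsto hγ hv ha

theorem dotOn_log {r : ℝ} (hr : r ∈ Ioc 0 γ) : dotOn γ u r = du r :=
  (h.solvesOn_log r hr).1.derivWithin ((uniqueDiffOn_Ioc 0 γ) r hr)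

theorem isNormalizedSolution : IsNormalizedSolution E γ u where
  continuousOn := h.continuous_log.continuousOn
  differentiableOn r hr := (h.solvesOn_log r hr).1.differentiableWithinAt
  differentiableOn_dot r hr := ((h.solvesOn_log r hr).2.congr (fun _ hy => h.dotOn_log hy)
    (h.dotOn_log hr)).differentiableWithinAt
  equation r hr := by
    have := ((h.solvesOn_log r hr).2.congr (fun _ hy => h.dotOn_log hy)
      (h.dotOn_log hr)).derivWithin ((uniqueDiffOn_Ioc 0 γ) r hr)
    change derivWithin (dotOn γ u) (Ioc 0 γ) r + _ = 0
    rw [this, coulombCoeff]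
    ring
  left_bc := h.log_zero

theorem eqOn_of_isNormalizedSolution {w : ℝ → ℝ} (hγ : 0 < γ) (hw : IsNormalizedSolution E γ w) :
    ∃ β : ℝ, EqOn w (fun r => u r + β * φ r) (Icc 0 γ) ∧
      EqOn (dotOn γ w) (fun r => du r + β * dφ r) (Ioc 0 γ) := by
  obtain ⟨β, hβ⟩ := h.exists_eq_of_isNormalizedSolution hγ hw
  refine ⟨β, fun r hr => ?_, fun r hr => (hβ r hr).2⟩
  rcases hr.1.eq_or_lt with rfl | h0
  · simp [hw.left_bc, h.log_zero, h.reg_zero]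
  · exact (hβ r ⟨h0, hr.2⟩).1

theorem hasUniqueSolution_odd (hγ : 0 < γ) (hne : dφ γ ≠ 0) :
    HasUniqueSolution γ (SolvesOddBVP E γ) := by
  have hm : γ ∈ Ioc 0 γ := ⟨hγ, le_rfl⟩
  have h' := h.add_mul_reg (-(du γ / dφ γ))
  refine ⟨_, ⟨h'.isNormalizedSolution, ?_⟩, fun v hv => ?_⟩
  · rw [h'.dotOn_log hm]
    field_simp
    ring
  · obtain ⟨β, h1, h2⟩ := h.eqOn_of_isNormalizedSolution hγ hv.1
    have h3 := h2 hm
    rw [hv.2] at h3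
    have : β = -(du γ / dφ γ) := by
      field_simp
      linarith
    rwa [this] at h1

theorem hasUniqueSolution_even (hγ : 0 < γ) (hne : φ γ ≠ 0) :
    HasUniqueSolution γ (SolvesEvenBVP E γ) := by
  have hm : γ ∈ Icc 0 γ := ⟨hγ.le, le_rfl⟩
  have h' := h.add_mul_reg (-(u γ / φ γ))
  refine ⟨_, ⟨h'.isNormalizedSolution, ?_⟩, fun v hv => ?_⟩
  · field_simp
    ring
  · obtain ⟨β, h1, h2⟩ := h.eqOn_of_isNormalizedSolution hγ hv.1
    have h3 := h1 hm
    rw [hv.2] at h3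
    have : β = -(u γ / φ γ) := by
      field_simp
      linarith
    rwa [this] at h1

end IsFundamentalPair

/-! ### Whittaker functions on the imaginary axis -/

theorem ExpBounded.hasSum_mul_derivCoeff {𝕜 : Type*} [RCLike 𝕜] {c : ℕ → 𝕜} (hc : ExpBounded c)
    (z : 𝕜) : HasSum (fun n : ℕ => (n : 𝕜) * c n * z ^ n) (z * powSum (_root_.derivCoeff c) z) := by
  rw [← hasSum_nat_add_iff' 1]
  have h := (hc.derivCoeff.summable z).hasSum.mul_left z
  simp only [Finset.range_one, Finset.sum_singleton, Nat.cast_zero, zero_mul, sub_zero]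
  refine (congrArg (HasSum · _ _) (funext fun n => ?_)).mpr h
  simp only [_root_.derivCoeff]
  push_cast
  ring

/-- The coefficients of `M(a, 2, z)`. -/
noncomputable def kummerCoeff (a : ℂ) (n : ℕ) : ℂ :=
  (ascPochhammer ℂ n).eval a / ((ascPochhammer ℂ n).eval 2 * (n.factorial : ℂ))

theorem ascPochhammer_eval_two_ne_zero (n : ℕ) : (ascPochhammer ℂ n).eval (2 : ℂ) ≠ 0 := by
  have h := ascPochhammer_pos (S := ℕ) n 2 (by norm_num)
  have h2 := ascPochhammer_eval_cast (S := ℂ) n 2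
  rw [show (2 : ℂ) = ((2 : ℕ) : ℂ) by norm_num, ← h2]
  exact_mod_cast h.ne'

theorem kummerCoeff_succ (a : ℂ) (n : ℕ) :
    ((n : ℂ) + 1) * (n + 2) * kummerCoeff a (n + 1) = (a + n) * kummerCoeff a n := by
  have h0 := ascPochhammer_eval_two_ne_zero n
  have h1 : ((n : ℂ) + 1) ≠ 0 := by exact_mod_cast n.succ_ne_zero
  have h2 : (2 : ℂ) + n ≠ 0 := by exact_mod_cast (by omega : 2 + n ≠ 0)
  have h3 : (n.factorial : ℂ) ≠ 0 := by exact_mod_cast n.factorial_ne_zero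
  rw [kummerCoeff, kummerCoeff, ascPochhammer_succ_eval, ascPochhammer_succ_eval,
    Nat.factorial_succ]
  push_cast
  field_simp
  ring

/-- The bound on `a` gives `‖a + n‖ ≤ n + 2`, which cancels a factor of the recursion and leaves `1
/ (n + 1)`. -/
theorem expBounded_kummerCoeff {a : ℂ} (ha : ‖a‖ ≤ 2) : ExpBounded (kummerCoeff a) := by
  refine ⟨1, 1, by norm_num, by norm_num, fun n => ?_⟩
  simp only [one_pow, mul_one]
  induction n with
  | zero => simp [kummerCoeff]
  | succ n ih =>
    have hn : (0 : ℝ) ≤ n := n.cast_nonneg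
    have h := congrArg norm (kummerCoeff_succ a n)
    have e1 : ‖((n : ℂ) + 1) * (n + 2)‖ = ((n : ℝ) + 1) * (n + 2) := by
      rw [show ((n : ℂ) + 1) * (n + 2) = (((n + 1) * (n + 2) : ℕ) : ℂ) by push_cast; ring,
        Complex.norm_natCast]
      push_cast
      ring
    rw [norm_mul, e1, norm_mul] at h
    have e2 : ‖a + n‖ ≤ n + 2 := (norm_add_le _ _).trans (by rw [Complex.norm_natCast]; linarith)
    rw [Nat.factorial_succ]
    push_cast
    rw [le_div_iff₀ (by positivity)]
    rw [le_div_iff₀ (by positivity)] at ih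
    have h2 : ((n : ℝ) + 1) * (n + 2) * ‖kummerCoeff a (n + 1)‖ ≤ (n + 2) * ‖kummerCoeff a n‖ := by
      rw [h]
      gcongr
    have h3 : ((n : ℝ) + 1) * ‖kummerCoeff a (n + 1)‖ ≤ ‖kummerCoeff a n‖ := by
      nlinarith
    calc _ = ((n : ℝ) + 1) * ‖kummerCoeff a (n + 1)‖ * n.factorial := by ring
      _ ≤ ‖kummerCoeff a n‖ * n.factorial := by gcongr
      _ ≤ 1 := ih

/-- Kummer's equation. -/
theorem powSum_kummerCoeff_equation {a : ℂ} (ha : ‖a‖ ≤ 2) (z : ℂ) :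
    z * powSum (derivCoeff (derivCoeff (kummerCoeff a))) z
      + (2 - z) * powSum (derivCoeff (kummerCoeff a)) z - a * powSum (kummerCoeff a) z = 0 := by
  have hk := expBounded_kummerCoeff ha
  have h := ((hk.derivCoeff.hasSum_mul_derivCoeff z).add
    ((hk.derivCoeff.summable z).hasSum.mul_left 2)).sub
    ((hk.hasSum_mul_derivCoeff z).add ((hk.summable z).hasSum.mul_left a))
  have h0 := h.unique (a₂ := 0) ?_
  · simp only [powSum] at h0 ⊢
    linear_combination h0
  · refine (congrArg (HasSum · _ _) (funext fun n => ?_)).mpr hasSum_zero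
    have := kummerCoeff_succ a n
    simp only [derivCoeff]
    linear_combination z ^ n * this

/-- The derivative of `M_{κ,1/2}`. -/
noncomputable def dwhittakerHalf (κ z : ℂ) : ℂ :=
  Complex.exp (-z / 2) * (powSum (kummerCoeff (1 - κ)) z
    + z * powSum (derivCoeff (kummerCoeff (1 - κ))) z - z * powSum (kummerCoeff (1 - κ)) z / 2)

/-- For `μ = 1/2` the power has exponent `1`, so no branch cut remains and the function is entire.
-/
theorem whittakerM_half (κ z : ℂ) :
    whittakerM κ (1 / 2) z = Complex.exp (-z / 2) * z * powSum (kummerCoeff (1 - κ)) z := by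
  have h1 : (1 / 2 + 1 / 2 : ℂ) = 1 := by norm_num
  have h2 : (1 + 2 * (1 / 2) : ℂ) = 2 := by norm_num
  rw [whittakerM, h1, h2, Complex.cpow_one]
  rfl

theorem hasDerivAt_exp_neg_half (z : ℂ) :
    HasDerivAt (fun z : ℂ => Complex.exp (-z / 2)) (-Complex.exp (-z / 2) / 2) z := by
  refine ((hasDerivAt_neg z).div_const 2).cexp.congr_deriv ?_
  ring

theorem hasDerivAt_whittakerM_half {κ : ℂ} (hκ : ‖1 - κ‖ ≤ 2) (z : ℂ) :
    HasDerivAt (whittakerM κ (1 / 2)) (dwhittakerHalf κ z) z := by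
  rw [funext (whittakerM_half κ)]
  refine (((hasDerivAt_exp_neg_half z).mul (hasDerivAt_id z)).mul
    ((expBounded_kummerCoeff hκ).hasDerivAt z)).congr_deriv ?_
  simp only [dwhittakerHalf, id, Pi.mul_apply]
  ring

/-- This is Whittaker's equation, whose `z⁻²` term vanishes for `μ = 1/2`. -/
theorem hasDerivAt_dwhittakerHalf {κ : ℂ} (hκ : ‖1 - κ‖ ≤ 2) {z : ℂ} (hz : z ≠ 0) :
    HasDerivAt (dwhittakerHalf κ) ((1 / 4 - κ / z) * whittakerM κ (1 / 2) z) z := by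
  have hk := expBounded_kummerCoeff hκ
  refine ((hasDerivAt_exp_neg_half z).mul (((hk.hasDerivAt z).add
    ((hasDerivAt_id z).mul (hk.derivCoeff.hasDerivAt z))).sub
    (((hasDerivAt_id z).mul (hk.hasDerivAt z)).div_const 2))).congr_deriv ?_
  have h := powSum_kummerCoeff_equation hκ z
  rw [whittakerM_half]
  simp only [id, Pi.add_apply, Pi.sub_apply, Pi.mul_apply]
  field_simp
  linear_combination 16 * h

/-- On the imaginary axis `M_{κ,1/2}` is `i` times the regular solution. -/
theorem whittakerM_half_I_mul {E : ℝ} (hE : |E| ≤ 1) {r : ℝ} (hr : 0 < r) :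
    whittakerM (-(E * Complex.I)) (1 / 2) (Complex.I * r) = Complex.I * regSol E r ∧
      deriv (whittakerM (-(E * Complex.I)) (1 / 2)) (Complex.I * r) = dregSol E r := by
  set κ : ℂ := -(E * Complex.I) with hκ
  have hκ2 : ‖1 - κ‖ ≤ 2 := by
    refine (norm_sub_le _ _).trans ?_
    simp only [hκ, norm_neg, norm_mul, Complex.norm_I, Complex.norm_real, Real.norm_eq_abs,
      norm_one]
    linarith
  have hk := expBounded_kummerCoeff hκ2
  set f : ℝ → ℂ := fun r => -Complex.I * whittakerM κ (1 / 2) (Complex.I * r) with hf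
  set f' : ℝ → ℂ := fun r => dwhittakerHalf κ (Complex.I * r) with hf'
  have hline : ∀ r : ℝ, HasDerivAt (fun x : ℝ => Complex.I * (x : ℂ)) Complex.I r := fun r => by
    simpa using (Complex.ofRealCLM.hasDerivAt (x := r)).const_mul Complex.I
  have hdf : ∀ r : ℝ, HasDerivAt f (f' r) r := fun r => by
    refine (((hasDerivAt_whittakerM_half hκ2 (Complex.I * r)).comp_of_eq r (hline r)
      rfl).const_mul (-Complex.I)).congr_deriv ?_
    linear_combination -f' r * Complex.I_mul_I
  -- With `κ = -iE` and `z = ir` one has `κ / z = -E / r`, so Whittaker's equation becomes the real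
  -- equation.
  have hddf : ∀ r : ℝ, 0 < r → HasDerivAt f' (-(coulombCoeff E r * f r)) r := fun r hr => by
    have hr0 : (r : ℂ) ≠ 0 := by exact_mod_cast hr.ne'
    refine ((hasDerivAt_dwhittakerHalf hκ2 (mul_ne_zero Complex.I_ne_zero hr0)).comp_of_eq r
      (hline r) rfl).congr_deriv ?_
    simp only [hf, coulombCoeff, hκ]
    push_cast
    have := Complex.I_ne_zero
    field_simp
    ring
  have hf0 : f 0 = 0 := by simp only [hf, whittakerM_half]; simp
  have hf'0 : f' 0 = 1 := by simp [hf', dwhittakerHalf, hk.powSum_zero, kummerCoeff]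
  have hf'c : Continuous f' := by
    have h1 : Continuous (dwhittakerHalf κ) := by
      have h2 := hk.continuous
      have h3 := hk.derivCoeff.continuous
      unfold dwhittakerHalf
      fun_prop
    exact h1.comp (by fun_prop)
  have hpair := isFundamentalPair_logSol hE
  -- A real functional of `f` solves the real equation and vanishes at `0`, hence is a multiple of
  -- `φ`; the factor is read off from the derivative at `0`. Real and imaginary parts then give `f =
  -- φ`.
  have main : ∀ (L : ℂ →L[ℝ] ℝ), L (f r) = L 1 * regSol E r ∧ L (f' r) = L 1 * dregSol E r := by
    intro L
    have hs : SolvesOn (coulombCoeff E) (Ioc 0 r) (fun x => L (f x)) (fun x => L (f' x)) := by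
      intro x hx
      refine ⟨(L.hasFDerivAt.comp_hasDerivAt x (hdf x)).hasDerivWithinAt, ?_⟩
      refine (L.hasFDerivAt.comp_hasDerivAt x (hddf x hx.1)).hasDerivWithinAt.congr_deriv ?_
      rw [map_neg, ← Complex.real_smul, map_smul, smul_eq_mul]
    have hfc : Continuous f := continuous_iff_continuousAt.mpr fun x => (hdf x).continuousAt
    have ht : Tendsto (fun x => L (f x)) (𝓝[>] 0) (𝓝 0) := by
      have hLc : Continuous fun x => L (f x) := L.continuous.comp hfc
      simpa [hf0] using (hLc.tendsto 0).mono_left (nhdsWithin_le_nhds (s := Ioi 0))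
    obtain ⟨β, hβ⟩ := hpair.exists_eq_of_tendsto hr hs ht
    simp only [zero_mul, zero_add] at hβ
    have ht1 : Tendsto (fun x => L (f' x)) (𝓝[>] 0) (𝓝 (L 1)) := by
      have hLc : Continuous fun x => L (f' x) := L.continuous.comp hf'c
      simpa [hf'0] using (hLc.tendsto 0).mono_left (nhdsWithin_le_nhds (s := Ioi 0))
    have ht2 : Tendsto (fun x => β * dregSol E x) (𝓝[>] 0) (𝓝 β) := by
      have := ((hpair.continuous_dreg.const_mul β).tendsto 0).mono_left
        (nhdsWithin_le_nhds (s := Ioi 0))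
      simpa [hpair.dreg_zero] using this
    have hev : (fun x => L (f' x)) =ᶠ[𝓝[>] 0] fun x => β * dregSol E x := by
      filter_upwards [Ioc_mem_nhdsGT hr] with x hx using (hβ x hx).2
    rw [tendsto_nhds_unique (ht1.congr' hev) ht2]
    exact hβ r ⟨hr, le_rfl⟩
  have hre := main Complex.reCLM
  have him := main Complex.imCLM
  simp only [Complex.reCLM_apply, Complex.imCLM_apply, Complex.one_re, Complex.one_im, one_mul,
    zero_mul] at hre him
  have e1 : f r = regSol E r := Complex.ext (by simpa using hre.1) (by simpa using him.1)
  have e2 : f' r = dregSol E r := Complex.ext (by simpa using hre.2) (by simpa using him.2)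
  constructor
  · rw [← e1]
    simp only [hf]
    linear_combination whittakerM κ (1 / 2) (Complex.I * r) * Complex.I_mul_I
  · rw [(hasDerivAt_whittakerM_half hκ2 _).deriv]
    exact e2

/-! ### Counting by interleaving -/

theorem encard_le_of_interleaved {A B : Set ℝ}
    (h : ∀ x ∈ A, ∀ y ∈ A, x < y → ∃ z ∈ B, x < z ∧ z < y) : A.encard ≤ B.encard + 1 := by
  rcases B.finite_or_infinite with hB | hB
  · by_contra! hlt
    lift B to Finset ℝ using hB
    rw [encard_coe_eq_coe_finsetCard] at hlt
    obtain ⟨t, htA, ht⟩ := exists_subset_encard_eq (s := A) (k := ((B.card + 2 : ℕ) : ℕ∞)) (by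
      have := Order.add_one_le_of_lt hlt
      refine le_trans (le_of_eq ?_) this
      push_cast
      rw [add_assoc, one_add_one_eq_two])
    have htf : t.Finite := finite_of_encard_eq_coe ht
    lift t to Finset ℝ using htf
    have := Finset.card_le_of_interleaved (s := t) (t := B)
      fun x hx y hy hxy _ => h x (htA hx) y (htA hy) hxy
    rw [encard_coe_eq_coe_finsetCard] at ht
    have ht' : t.card = B.card + 2 := by exact_mod_cast ht
    omega
  · simp [hB.encard_eq]

/-- Adjoining the left endpoint to `A` adds one gap, which removes the `+ 1` of the general bound.
-/
theorem encard_le_of_interleaved_left {A B : Set ℝ} {a : ℝ} (ha : ∀ x ∈ A, a < x)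
    (h0 : ∀ x ∈ A, ∃ z ∈ B, a < z ∧ z < x)
    (h : ∀ x ∈ A, ∀ y ∈ A, x < y → ∃ z ∈ B, x < z ∧ z < y) : A.encard ≤ B.encard := by
  have h1 := encard_le_of_interleaved (A := insert a A) (B := B) (by
    rintro x (rfl | hx) y (rfl | hy) hxy
    · exact absurd hxy (lt_irrefl _)
    · exact h0 y hy
    · exact absurd hxy (ha x hx).not_gt
    · exact h x hx y hy hxy)
  rw [encard_insert_of_notMem fun hA => lt_irrefl _ (ha a hA)] at h1
  exact (ENat.add_le_add_iff_right ENat.one_ne_top).mp h1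

theorem encard_le_of_interleaved_right {A B : Set ℝ} {b : ℝ} (hb : ∀ x ∈ A, x < b)
    (h0 : ∀ x ∈ A, ∃ z ∈ B, x < z ∧ z < b)
    (h : ∀ x ∈ A, ∀ y ∈ A, x < y → ∃ z ∈ B, x < z ∧ z < y) : A.encard ≤ B.encard := by
  have h1 := encard_le_of_interleaved (A := insert b A) (B := B) (by
    rintro x (rfl | hx) y (rfl | hy) hxy
    · exact absurd hxy (lt_irrefl _)
    · exact absurd hxy (hb y hy).not_gt
    · exact h0 x hx
    · exact h x hx y hy hxy)
  rw [encard_insert_of_notMem fun hA => lt_irrefl _ (hb b hA)] at h1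
  exact (ENat.add_le_add_iff_right ENat.one_ne_top).mp h1

/-- The zeros of `f` in `(0, x]`. -/
def zerosIoc (f : ℝ → ℝ) (x : ℝ) : Set ℝ := {t | t ∈ Ioc 0 x ∧ f t = 0}

/-- The zeros of `f` in `(0, x)`. -/
def zerosIoo (f : ℝ → ℝ) (x : ℝ) : Set ℝ := {t | t ∈ Ioo 0 x ∧ f t = 0}

theorem encard_zerosIoc_of_eq_zero {f : ℝ → ℝ} {x : ℝ} (hx : 0 < x) (hf : f x = 0) :
    (zerosIoc f x).encard = (zerosIoo f x).encard + 1 := by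
  rw [← encard_insert_of_notMem (a := x) fun h => lt_irrefl _ h.1.2]
  congr 1
  ext t
  constructor
  · rintro ⟨⟨h0, h1⟩, h2⟩
    rcases h1.eq_or_lt with rfl | h3
    · exact Or.inl rfl
    · exact Or.inr ⟨⟨h0, h3⟩, h2⟩
  · rintro (rfl | ⟨⟨h0, h1⟩, h2⟩)
    · exact ⟨⟨hx, le_rfl⟩, hf⟩
    · exact ⟨⟨h0, h1.le⟩, h2⟩

theorem zerosIoo_subset_zerosIoc (f : ℝ → ℝ) (x : ℝ) : zerosIoo f x ⊆ zerosIoc f x :=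
  fun _ h => ⟨⟨h.1.1, h.1.2.le⟩, h.2⟩

theorem zerosIoc_mono (f : ℝ → ℝ) {x y : ℝ} (h : x ≤ y) : zerosIoc f x ⊆ zerosIoc f y :=
  fun _ ht => ⟨⟨ht.1.1, ht.1.2.trans h⟩, ht.2⟩

/-! ### Sturm comparison -/

/-- Rolle's theorem for the quotient of two functions with nonvanishing Wronskian. -/
theorem exists_zero_of_wronskian_ne_zero {f f' g g' : ℝ → ℝ} {a b : ℝ} (hab : a < b)
    (hfc : ContinuousOn f (Icc a b)) (hgc : ContinuousOn g (Icc a b))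
    (hf : ∀ x ∈ Ioo a b, HasDerivAt f (f' x) x) (hg : ∀ x ∈ Ioo a b, HasDerivAt g (g' x) x)
    (hW : ∀ x ∈ Ioo a b, f' x * g x - f x * g' x ≠ 0)
    (hfa : f a = 0) (hfb : f b = 0) (hga : g a ≠ 0) (hgb : g b ≠ 0) :
    ∃ c ∈ Ioo a b, g c = 0 := by
  by_contra! hne
  have hne' : ∀ x ∈ Icc a b, g x ≠ 0 := by
    intro x hx
    rcases hx.1.eq_or_lt with rfl | h1
    · exact hga
    rcases hx.2.eq_or_lt with rfl | h2
    · exact hgb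
    exact hne x ⟨h1, h2⟩
  obtain ⟨c, hc, hc0⟩ := exists_hasDerivAt_eq_zero hab (hfc.div hgc hne')
    (by simp [hfa, hfb]) fun x hx => (hf x hx).div (hg x hx) (hne x hx)
  rw [div_eq_zero_iff] at hc0
  rcases hc0 with h | h
  · exact hW c hc h
  · exact hne c hc (by simpa using h)

/-- The quotient of two functions with positive Wronskian increases. -/
theorem div_lt_div_of_wronskian_pos {f f' g g' : ℝ → ℝ} {a b : ℝ} (hab : a < b)
    (hfc : ContinuousOn f (Icc a b)) (hgc : ContinuousOn g (Icc a b))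
    (hf : ∀ x ∈ Ioo a b, HasDerivAt f (f' x) x) (hg : ∀ x ∈ Ioo a b, HasDerivAt g (g' x) x)
    (hW : ∀ x ∈ Ioo a b, 0 < f' x * g x - f x * g' x) (hne : ∀ x ∈ Icc a b, g x ≠ 0) :
    f a / g a < f b / g b := by
  refine strictMonoOn_of_deriv_pos (convex_Icc a b) (hfc.div hgc hne) (fun x hx => ?_)
    (left_mem_Icc.mpr hab.le) (right_mem_Icc.mpr hab.le) hab
  rw [interior_Icc] at hx
  have hx0 := hne x (Ioo_subset_Icc_self hx)
  rw [((hf x hx).div (hg x hx) hx0).deriv]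
  exact div_pos (hW x hx) (by positivity)

theorem exists_zero_of_mul_neg {f : ℝ → ℝ} {a b : ℝ} (hab : a < b) (hf : ContinuousOn f (Icc a b))
    (h : f a * f b < 0) : ∃ c ∈ Ioo a b, f c = 0 := by
  rcases mul_neg_iff.mp h with ⟨h1, h2⟩ | ⟨h1, h2⟩
  · exact intermediate_value_Ioo' hab.le hf ⟨h2, h1⟩
  · exact intermediate_value_Ioo hab.le hf ⟨h1, h2⟩

namespace IsFundamentalPair

variable {E γ : ℝ} {φ dφ u du : ℝ → ℝ} (h : IsFundamentalPair E φ dφ u du)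
include h

theorem log_ne_zero_of_reg_eq_zero {r : ℝ} (hr : 0 ≤ r) (hφ : φ r = 0) : u r ≠ 0 := by
  rcases hr.eq_or_lt with rfl | hr
  · simp [h.log_zero]
  · intro hu
    have := h.wronskian r hr
    simp [hφ, hu] at this

theorem reg_ne_zero_of_log_eq_zero {r : ℝ} (hr : 0 ≤ r) (hu : u r = 0) : φ r ≠ 0 :=
  fun hφ => h.log_ne_zero_of_reg_eq_zero hr hφ hu

theorem dlog_ne_zero_of_dreg_eq_zero {r : ℝ} (hr : 0 < r) (hφ : dφ r = 0) : du r ≠ 0 := by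
  intro hu
  have := h.wronskian r hr
  simp [hφ, hu] at this

theorem reg_ne_zero_of_dreg_eq_zero {r : ℝ} (hr : 0 < r) (hφ : dφ r = 0) : φ r ≠ 0 := by
  intro hu
  have := h.wronskian r hr
  simp [hφ, hu] at this

theorem continuousOn_dlog {a b : ℝ} (ha : 0 < a) : ContinuousOn du (Icc a b) := fun x hx =>
  (h.hasDerivAt_dlog x (ha.trans_le hx.1)).continuousAt.continuousWithinAt

theorem exists_log_eq_zero {a b : ℝ} (ha : 0 ≤ a) (hab : a < b) (hφa : φ a = 0) (hφb : φ b = 0) :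
    ∃ c ∈ Ioo a b, u c = 0 :=
  exists_zero_of_wronskian_ne_zero hab h.continuous_reg.continuousOn h.continuous_log.continuousOn
    (fun x _ => h.hasDerivAt_reg x) (fun x hx => h.hasDerivAt_log x (ha.trans_lt hx.1))
    (fun x hx => by
      have := h.wronskian x (ha.trans_lt hx.1)
      intro h0
      linarith) hφa hφb
    (h.log_ne_zero_of_reg_eq_zero ha hφa) (h.log_ne_zero_of_reg_eq_zero (ha.trans hab.le) hφb)

theorem exists_reg_eq_zero {a b : ℝ} (ha : 0 ≤ a) (hab : a < b) (hua : u a = 0) (hub : u b = 0) :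
    ∃ c ∈ Ioo a b, φ c = 0 :=
  exists_zero_of_wronskian_ne_zero hab h.continuous_log.continuousOn h.continuous_reg.continuousOn
    (fun x hx => h.hasDerivAt_log x (ha.trans_lt hx.1)) (fun x _ => h.hasDerivAt_reg x)
    (fun x hx => by
      have := h.wronskian x (ha.trans_lt hx.1)
      intro h0
      linarith)
    hua hub (h.reg_ne_zero_of_log_eq_zero ha hua) (h.reg_ne_zero_of_log_eq_zero (ha.trans hab.le) hub)

theorem exists_dreg_eq_zero {a b : ℝ} (hab : a < b) (hφa : φ a = 0) (hφb : φ b = 0) :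
    ∃ c ∈ Ioo a b, dφ c = 0 :=
  exists_hasDerivAt_eq_zero hab h.continuous_reg.continuousOn (hφa.trans hφb.symm)
    fun x _ => h.hasDerivAt_reg x

theorem exists_reg_eq_zero_of_dreg {a b : ℝ} (ha : 0 < a) (hab : a < b)
    (hq : ∀ r ∈ Ioo a b, 0 < coulombCoeff E r) (hφa : dφ a = 0) (hφb : dφ b = 0) :
    ∃ c ∈ Ioo a b, φ c = 0 := by
  obtain ⟨c, hc, h0⟩ := exists_hasDerivAt_eq_zero hab h.continuous_dreg.continuousOn
    (hφa.trans hφb.symm) fun x hx => h.hasDerivAt_dreg x (ha.trans hx.1)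
  exact ⟨c, hc, by simpa [(hq c hc).ne'] using h0⟩

theorem exists_log_eq_zero_of_dlog {a b : ℝ} (ha : 0 < a) (hab : a < b)
    (hq : ∀ r ∈ Ioo a b, 0 < coulombCoeff E r) (hua : du a = 0) (hub : du b = 0) :
    ∃ c ∈ Ioo a b, u c = 0 := by
  obtain ⟨c, hc, h0⟩ := exists_hasDerivAt_eq_zero hab (h.continuousOn_dlog ha)
    (hua.trans hub.symm) fun x hx => h.hasDerivAt_dlog x (ha.trans hx.1)
  exact ⟨c, hc, by simpa [(hq c hc).ne'] using h0⟩

/-- The Wronskian `φ'' u' - φ' u''` equals `q`, so positivity of `q` permits the quotient form of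
Rolle's theorem. -/
theorem exists_dlog_eq_zero_of_dreg {a b : ℝ} (ha : 0 < a) (hab : a < b)
    (hq : ∀ r ∈ Ioo a b, 0 < coulombCoeff E r) (hφa : dφ a = 0) (hφb : dφ b = 0) :
    ∃ c ∈ Ioo a b, du c = 0 :=
  exists_zero_of_wronskian_ne_zero hab h.continuous_dreg.continuousOn (h.continuousOn_dlog ha)
    (fun x hx => h.hasDerivAt_dreg x (ha.trans hx.1))
    (fun x hx => h.hasDerivAt_dlog x (ha.trans hx.1))
    (fun x hx => by
      have h1 := h.wronskian x (ha.trans hx.1)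
      have h2 := hq x hx
      have : -(coulombCoeff E x * φ x) * du x - dφ x * -(coulombCoeff E x * u x)
        = coulombCoeff E x := by linear_combination -coulombCoeff E x * h1
      rw [this]
      exact h2.ne') hφa hφb
    (h.dlog_ne_zero_of_dreg_eq_zero ha hφa) (h.dlog_ne_zero_of_dreg_eq_zero (ha.trans hab) hφb)

theorem exists_dreg_eq_zero_of_dlog {a b : ℝ} (ha : 0 < a) (hab : a < b)
    (hq : ∀ r ∈ Ioo a b, 0 < coulombCoeff E r) (hua : du a = 0) (hub : du b = 0) :
    ∃ c ∈ Ioo a b, dφ c = 0 :=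
  exists_zero_of_wronskian_ne_zero hab (h.continuousOn_dlog ha) h.continuous_dreg.continuousOn
    (fun x hx => h.hasDerivAt_dlog x (ha.trans hx.1))
    (fun x hx => h.hasDerivAt_dreg x (ha.trans hx.1))
    (fun x hx => by
      have h1 := h.wronskian x (ha.trans hx.1)
      have h2 := hq x hx
      have : -(coulombCoeff E x * u x) * dφ x - du x * -(coulombCoeff E x * φ x)
        = -coulombCoeff E x := by linear_combination coulombCoeff E x * h1
      rw [this]
      exact neg_ne_zero.mpr h2.ne') hua hub
    (fun h0 => h.dlog_ne_zero_of_dreg_eq_zero ha h0 hua)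
    (fun h0 => h.dlog_ne_zero_of_dreg_eq_zero (ha.trans hab) h0 hub)

omit h in
theorem coulombCoeff_pos {E r : ℝ} (hE : 0 < E) (hr : 0 < r) : 0 < coulombCoeff E r := by
  rw [coulombCoeff]
  positivity

/-- On `(0, 4)` one has `q < 0`, so `(φφ')' = φ'² - qφ²` is positive there, while `φφ'` vanishes at
`0` and at `p`. -/
theorem four_lt_of_dreg_eq_zero (hE : E = -1) {p : ℝ} (hp : 0 < p) (hφ : dφ p = 0) : 4 < p := by
  by_contra! hp4
  obtain ⟨c, hc, h0⟩ := exists_hasDerivAt_eq_zero (f := fun x => φ x * dφ x) hp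
    (h.continuous_reg.mul h.continuous_dreg).continuousOn (by simp [hφ, h.reg_zero])
    fun x hx => (h.hasDerivAt_reg x).mul (h.hasDerivAt_dreg x hx.1)
  have hq : coulombCoeff E c < 0 := by
    have h4 : c < 4 := hc.2.trans_le hp4
    have : 1 / 4 < 1 / c := one_div_lt_one_div_of_lt hc.1 h4
    rw [coulombCoeff, hE, neg_div]
    linarith
  have h1 : dφ c ^ 2 + -coulombCoeff E c * φ c ^ 2 = 0 := by linear_combination h0
  have h2 : 0 ≤ -coulombCoeff E c * φ c ^ 2 := mul_nonneg (by linarith) (sq_nonneg _)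
  have h3 : dφ c = 0 := by
    have := sq_nonneg (dφ c)
    exact pow_eq_zero_iff (two_ne_zero) |>.mp (by linarith)
  refine h.reg_ne_zero_of_dreg_eq_zero hc.1 h3 ?_
  rw [h3] at h1
  simpa [hq.ne] using h1

theorem coulombCoeff_pos_of_dreg_eq_zero (hE : E = 1 ∨ E = -1) {p r : ℝ} (hp : 0 < p)
    (hφ : dφ p = 0) (hr : p ≤ r) : 0 < coulombCoeff E r := by
  rcases hE with hE | hE
  · exact coulombCoeff_pos (by linarith) (hp.trans_le hr)
  · have h4 := (h.four_lt_of_dreg_eq_zero hE hp hφ).trans_le hr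
    have : 1 / r < 1 / 4 := one_div_lt_one_div_of_lt (by norm_num) h4
    rw [coulombCoeff, hE, neg_div]
    linarith

theorem dlog_pos (hE : 0 < E) {p : ℝ} (hne : ∀ r ∈ Ioo 0 p, du r ≠ 0) {r : ℝ}
    (hr : r ∈ Ioo 0 p) : 0 < du r := by
  by_contra! hle
  have hlt := lt_of_le_of_ne hle (hne r hr)
  obtain ⟨s, hs, hsr⟩ := (((h.tendsto_dlog hE).eventually_gt_atTop 0).and
    (Ioo_mem_nhdsGT hr.1)).exists
  obtain ⟨c, hc, h0⟩ := exists_zero_of_mul_neg hsr.2 (h.continuousOn_dlog hsr.1)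
    (mul_neg_of_pos_of_neg hs hlt)
  exact hne c ⟨hsr.1.trans hc.1, hc.2.trans hr.2⟩ h0

theorem one_le_log (hE : 0 < E) {p : ℝ} (hne : ∀ r ∈ Ioo 0 p, du r ≠ 0) {r : ℝ}
    (hr : r ∈ Icc 0 p) : 1 ≤ u r := by
  have hm : MonotoneOn u (Icc 0 p) := by
    refine monotoneOn_of_deriv_nonneg (convex_Icc 0 p) h.continuous_log.continuousOn
      (fun x hx => ?_) fun x hx => ?_
    · rw [interior_Icc] at hx
      exact (h.hasDerivAt_log x hx.1).differentiableAt.differentiableWithinAt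
    · rw [interior_Icc] at hx
      rw [(h.hasDerivAt_log x hx.1).deriv]
      exact (h.dlog_pos hE hne hx).le
  have := hm ⟨le_rfl, hr.1.trans hr.2⟩ hr hr.1
  rwa [h.log_zero] at this

/-- The solution starts at `1` with positive slope, so it must turn before it can vanish. -/
theorem exists_dlog_eq_zero_of_log (hE : 0 < E) {p : ℝ} (hp : 0 < p) (hu : u p = 0) :
    ∃ c ∈ Ioo 0 p, du c = 0 := by
  by_contra! hne
  have := h.one_le_log hE hne (right_mem_Icc.mpr hp.le)
  linarith

/-- Without a critical point, `u ≥ 1` and `φ / u` increases from `0`, so `φ(p) > 0`. The Wronskian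
at `p` then forces `u'(p) < 0`, although `u'` is positive near `0`. -/
theorem exists_dlog_eq_zero_Ioo_zero (hE : 0 < E) {p : ℝ} (hp : 0 < p) (hφ : dφ p = 0) :
    ∃ c ∈ Ioo 0 p, du c = 0 := by
  by_contra! hne
  have hu : ∀ r ∈ Icc 0 p, 0 < u r := fun r hr => by linarith [h.one_le_log hE hne hr]
  have h1 := div_lt_div_of_wronskian_pos hp h.continuous_reg.continuousOn
    h.continuous_log.continuousOn (fun x _ => h.hasDerivAt_reg x)
    (fun x hx => h.hasDerivAt_log x hx.1)
    (fun x hx => by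
      have := h.wronskian x hx.1
      linarith) fun x hx => (hu x hx).ne'
  rw [h.reg_zero, zero_div, div_pos_iff_of_pos_right (hu p (right_mem_Icc.mpr hp.le))] at h1
  have h2 := h.wronskian p hp
  rw [hφ] at h2
  have h3 : du p < 0 := by
    by_contra! h0
    nlinarith
  have h4 : p / 2 ∈ Ioo 0 p := ⟨by linarith, by linarith⟩
  obtain ⟨c, hc, h0⟩ := exists_zero_of_mul_neg h4.2 (h.continuousOn_dlog h4.1)
    (mul_neg_of_pos_of_neg (h.dlog_pos hE hne h4) h3)
  exact hne c ⟨h4.1.trans hc.1, hc.2⟩ h0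

/-- The zero of `φ` at `0` opens the first gap. The right side omits `x` itself, which yields an
extra unit when `φ'(x) = 0`. -/
theorem encard_zerosIoc_reg_le (x : ℝ) :
    (zerosIoc φ x).encard ≤ (zerosIoo dφ x).encard := by
  refine encard_le_of_interleaved_left (a := 0) (fun t ht => ht.1.1) (fun t ht => ?_)
    fun s hs t ht hst => ?_
  · obtain ⟨c, hc, h0⟩ := h.exists_dreg_eq_zero ht.1.1 h.reg_zero ht.2
    exact ⟨c, ⟨⟨hc.1, hc.2.trans_le ht.1.2⟩, h0⟩, hc⟩
  · obtain ⟨c, hc, h0⟩ := h.exists_dreg_eq_zero hst hs.2 ht.2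
    exact ⟨c, ⟨⟨hs.1.1.trans hc.1, hc.2.trans_le ht.1.2⟩, h0⟩, hc⟩

theorem encard_zerosIoc_dreg_le (hE : E = 1 ∨ E = -1) (x : ℝ) :
    (zerosIoc dφ x).encard ≤ (zerosIoo φ x).encard + 1 := by
  refine encard_le_of_interleaved fun s hs t ht hst => ?_
  obtain ⟨c, hc, h0⟩ := h.exists_reg_eq_zero_of_dreg hs.1.1 hst
    (fun r hr => h.coulombCoeff_pos_of_dreg_eq_zero hE hs.1.1 hs.2 hr.1.le) hs.2 ht.2
  exact ⟨c, ⟨⟨hs.1.1.trans hc.1, hc.2.trans_le ht.1.2⟩, h0⟩, hc⟩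

theorem encard_zerosIoc_reg_le_log (x : ℝ) :
    (zerosIoc φ x).encard ≤ (zerosIoo u x).encard := by
  refine encard_le_of_interleaved_left (a := 0) (fun t ht => ht.1.1) (fun t ht => ?_)
    fun s hs t ht hst => ?_
  · obtain ⟨c, hc, h0⟩ := h.exists_log_eq_zero le_rfl ht.1.1 h.reg_zero ht.2
    exact ⟨c, ⟨⟨hc.1, hc.2.trans_le ht.1.2⟩, h0⟩, hc⟩
  · obtain ⟨c, hc, h0⟩ := h.exists_log_eq_zero hs.1.1.le hst hs.2 ht.2
    exact ⟨c, ⟨⟨hs.1.1.trans hc.1, hc.2.trans_le ht.1.2⟩, h0⟩, hc⟩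

theorem encard_zerosIoc_log_le (x : ℝ) :
    (zerosIoc u x).encard ≤ (zerosIoc φ x).encard + 1 := by
  refine encard_le_of_interleaved fun s hs t ht hst => ?_
  obtain ⟨c, hc, h0⟩ := h.exists_reg_eq_zero hs.1.1.le hst hs.2 ht.2
  exact ⟨c, ⟨⟨hs.1.1.trans hc.1, hc.2.le.trans ht.1.2⟩, h0⟩, hc⟩

/-- Zeros of a solution vanishing at `γ`. -/
theorem encard_zerosIoc_log_of_eq_zero (hγ : 0 < γ) (hu : u γ = 0) :
    (zerosIoc u γ).encard = (zerosIoc φ γ).encard + 1 := by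
  refine le_antisymm (h.encard_zerosIoc_log_le γ) ?_
  rw [encard_zerosIoc_of_eq_zero hγ hu]
  exact add_le_add_left (h.encard_zerosIoc_reg_le_log γ) 1

/-- For `E > 0`, critical points of a solution with a critical point at `γ`. -/
theorem encard_zerosIoc_dlog_of_eq_zero (hE : 0 < E) (hγ : 0 < γ) (hu : du γ = 0) :
    (zerosIoc du γ).encard = (zerosIoc dφ γ).encard + 1 := by
  refine le_antisymm (encard_le_of_interleaved fun s hs t ht hst => ?_) ?_
  · obtain ⟨c, hc, h0⟩ := h.exists_dreg_eq_zero_of_dlog hs.1.1 hst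
      (fun r hr => coulombCoeff_pos hE (hs.1.1.trans hr.1)) hs.2 ht.2
    exact ⟨c, ⟨⟨hs.1.1.trans hc.1, hc.2.le.trans ht.1.2⟩, h0⟩, hc⟩
  -- The critical point `γ` is set aside as the extra one; the zeros of `φ'` are matched inside `(0,
  -- γ)`.
  · rw [encard_zerosIoc_of_eq_zero hγ hu]
    refine add_le_add_left (encard_le_of_interleaved_left (a := 0) (fun t ht => ht.1.1)
      (fun t ht => ?_) fun s hs t ht hst => ?_) 1
    · obtain ⟨c, hc, h0⟩ := h.exists_dlog_eq_zero_Ioo_zero hE ht.1.1 ht.2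
      exact ⟨c, ⟨⟨hc.1, hc.2.trans_le ht.1.2⟩, h0⟩, hc⟩
    · obtain ⟨c, hc, h0⟩ := h.exists_dlog_eq_zero_of_dreg hs.1.1 hst
        (fun r hr => coulombCoeff_pos hE (hs.1.1.trans hr.1)) hs.2 ht.2
      exact ⟨c, ⟨⟨hs.1.1.trans hc.1, hc.2.trans_le ht.1.2⟩, h0⟩, hc⟩

/-- For `E > 0`, critical points of a solution vanishing at `γ`. -/
theorem encard_zerosIoc_dlog_of_log_eq_zero (hE : 0 < E) (hγ : 0 < γ) (hu : u γ = 0) :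
    (zerosIoc du γ).encard = (zerosIoc φ γ).encard + 1 := by
  rw [← h.encard_zerosIoc_log_of_eq_zero hγ hu]
  refine le_antisymm ?_ (encard_le_of_interleaved_left (a := 0) (fun t ht => ht.1.1)
      (fun t ht => ?_) fun s hs t ht hst => ?_)
  -- Critical points are separated by zeros inside `(0, γ)`; the `+ 1` is paid for by the zero at
  -- `γ`.
  · rw [encard_zerosIoc_of_eq_zero hγ hu]
    refine encard_le_of_interleaved fun s hs t ht hst => ?_
    obtain ⟨c, hc, h0⟩ := h.exists_log_eq_zero_of_dlog hs.1.1 hst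
      (fun r hr => coulombCoeff_pos hE (hs.1.1.trans hr.1)) hs.2 ht.2
    exact ⟨c, ⟨⟨hs.1.1.trans hc.1, hc.2.trans_le ht.1.2⟩, h0⟩, hc⟩
  · obtain ⟨c, hc, h0⟩ := h.exists_dlog_eq_zero_of_log hE ht.1.1 ht.2
    exact ⟨c, ⟨⟨hc.1, hc.2.le.trans ht.1.2⟩, h0⟩, hc⟩
  · obtain ⟨c, hc, h0⟩ := exists_hasDerivAt_eq_zero hst h.continuous_log.continuousOn
      (hs.2.trans ht.2.symm) fun x hx => h.hasDerivAt_log x (hs.1.1.trans hx.1)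
    exact ⟨c, ⟨⟨hs.1.1.trans hc.1, hc.2.le.trans ht.1.2⟩, h0⟩, hc⟩

/-- The mean slope from `x` to `γ` has the sign of `φ(γ)`, opposite to that of `φ'(γ)`. -/
theorem exists_dreg_eq_zero_of_mul_neg {x : ℝ} (hx : x < γ) (hφ : φ x = 0)
    (hneg : φ γ * dφ γ < 0) : ∃ c ∈ Ioo x γ, dφ c = 0 := by
  obtain ⟨c, hc, h0⟩ := exists_hasDerivAt_eq_slope φ dφ hx h.continuous_reg.continuousOn
    fun y _ => h.hasDerivAt_reg y
  obtain ⟨d, hd, hd0⟩ := exists_zero_of_mul_neg (f := dφ) hc.2 h.continuous_dreg.continuousOn (by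
    rw [h0, hφ, sub_zero, div_mul_eq_mul_div]
    exact div_neg_of_neg_of_pos hneg (by linarith))
  exact ⟨d, ⟨hc.1.trans hd.1, hd.2⟩, hd0⟩

/-- From `u'(γ) = 0` follows `u(γ) φ'(γ) = 1`, so `φ / u` is negative at `γ`; without zeros of `u`
it would increase from `0`. -/
theorem exists_log_eq_zero_of_mul_neg {x : ℝ} (hx0 : 0 ≤ x) (hx : x < γ) (hφ : φ x = 0)
    (hu : du γ = 0) (hneg : φ γ * dφ γ < 0) : ∃ c ∈ Ioo x γ, u c = 0 := by
  by_contra! hne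
  have hγ := hx0.trans_lt hx
  have h1 := h.wronskian γ hγ
  rw [hu] at h1
  have h2 := div_lt_div_of_wronskian_pos hx h.continuous_reg.continuousOn
    h.continuous_log.continuousOn (fun x _ => h.hasDerivAt_reg x)
    (fun y hy => h.hasDerivAt_log y (hx0.trans_lt hy.1))
    (fun y hy => by
      have := h.wronskian y (hx0.trans_lt hy.1)
      linarith) (fun y hy => by
      rcases hy.1.eq_or_lt with rfl | hy1
      · exact h.log_ne_zero_of_reg_eq_zero hx0 hφ
      rcases hy.2.eq_or_lt with rfl | hy2
      · intro h0
        simp [h0] at h1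
      exact hne y ⟨hy1, hy2⟩)
  rw [hφ, zero_div, div_pos_iff] at h2
  rcases h2 with ⟨h2, h3⟩ | ⟨h2, h3⟩ <;> nlinarith

/-- For `E = -1`, zeros of a solution with a critical point at `γ`. -/
theorem encard_zerosIoc_log_of_dlog_eq_zero (hE : E = -1) (hγ : 0 < γ) (hu : du γ = 0) :
    (zerosIoc u γ).encard = (zerosIoc dφ γ).encard := by
  have hw := h.wronskian γ hγ
  rw [hu] at hw
  have hE' : E = 1 ∨ E = -1 := Or.inr hE
  have hγm : γ ∈ Ioc 0 γ := ⟨hγ, le_rfl⟩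
  -- If `φφ' < 0` at `γ`, both counts are one more than the number of zeros of `φ`; otherwise both
  -- equal that number.
  rcases lt_or_ge (φ γ * dφ γ) 0 with hneg | hnn
  · have hmem : γ ∉ zerosIoc φ γ := fun hm => by simp [hm.2] at hneg
    trans (zerosIoc φ γ).encard + 1
    · refine le_antisymm (h.encard_zerosIoc_log_le γ) ?_
      rw [← encard_insert_of_notMem hmem]
      -- Here `γ` serves as a fictitious further zero of `φ`.
      have key : ∀ x, 0 ≤ x → φ x = 0 → ∀ y ∈ insert γ (zerosIoc φ γ), x < y →
          ∃ z ∈ zerosIoc u γ, x < z ∧ z < y := by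
        rintro x hx hφ y (rfl | hy) hxy
        · obtain ⟨c, hc, h0⟩ := h.exists_log_eq_zero_of_mul_neg hx hxy hφ hu hneg
          exact ⟨c, ⟨⟨hx.trans_lt hc.1, hc.2.le⟩, h0⟩, hc⟩
        · obtain ⟨c, hc, h0⟩ := h.exists_log_eq_zero hx hxy hφ hy.2
          exact ⟨c, ⟨⟨hx.trans_lt hc.1, hc.2.le.trans hy.1.2⟩, h0⟩, hc⟩
      have hpos : ∀ x ∈ insert γ (zerosIoc φ γ), 0 < x := by
        rintro x (rfl | hx)
        exacts [hγ, hx.1.1]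
      refine encard_le_of_interleaved_left hpos
        (fun x hx => key 0 le_rfl h.reg_zero x hx (hpos x hx)) ?_
      rintro x (rfl | hx) y hy hxy
      · rcases hy with rfl | hy
        · exact absurd hxy (lt_irrefl _)
        · exact absurd hxy hy.1.2.not_gt
      · exact key x hx.1.1.le hx.2 y hy hxy
    · refine (le_antisymm ((h.encard_zerosIoc_dreg_le hE' γ).trans
        (add_le_add_left (encard_le_encard (zerosIoo_subset_zerosIoc φ γ)) 1)) ?_).symm
      rw [← encard_insert_of_notMem hmem]
      have key : ∀ x, 0 ≤ x → φ x = 0 → ∀ y ∈ insert γ (zerosIoc φ γ), x < y →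
          ∃ z ∈ zerosIoc dφ γ, x < z ∧ z < y := by
        rintro x hx hφ y (rfl | hy) hxy
        · obtain ⟨c, hc, h0⟩ := h.exists_dreg_eq_zero_of_mul_neg hxy hφ hneg
          exact ⟨c, ⟨⟨hx.trans_lt hc.1, hc.2.le⟩, h0⟩, hc⟩
        · obtain ⟨c, hc, h0⟩ := h.exists_dreg_eq_zero hxy hφ hy.2
          exact ⟨c, ⟨⟨hx.trans_lt hc.1, hc.2.le.trans hy.1.2⟩, h0⟩, hc⟩
      have hpos : ∀ x ∈ insert γ (zerosIoc φ γ), 0 < x := by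
        rintro x (rfl | hx)
        exacts [hγ, hx.1.1]
      refine encard_le_of_interleaved_left hpos
        (fun x hx => key 0 le_rfl h.reg_zero x hx (hpos x hx)) ?_
      rintro x (rfl | hx) y hy hxy
      · rcases hy with rfl | hy
        · exact absurd hxy (lt_irrefl _)
        · exact absurd hxy hy.1.2.not_gt
      · exact key x hx.1.1.le hx.2 y hy hxy
  · have hdγ : dφ γ ≠ 0 := fun h0 => by simp [h0] at hw
    have huγ : u γ ≠ 0 := fun h0 => by simp [h0] at hw
    trans (zerosIoc φ γ).encard
    · refine le_antisymm ?_ ((h.encard_zerosIoc_reg_le_log γ).trans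
        (encard_le_encard (zerosIoo_subset_zerosIoc u γ)))
      -- Any bound beyond `γ` would do; the point is that the last zero of `u` is followed by a zero
      -- of `φ` up to `γ`.
      refine encard_le_of_interleaved_right (b := γ + 1) (fun x hx => by linarith [hx.1.2])
        (fun s hs => ?_) fun s hs t ht hst => ?_
      · by_contra! hne
        have hsγ : s < γ := lt_of_le_of_ne hs.1.2 fun h0 => huγ (h0 ▸ hs.2)
        have hφ : ∀ x ∈ Icc s γ, φ x ≠ 0 := by
          intro x hx h0
          rcases hx.1.eq_or_lt with rfl | hx1
          · exact h.reg_ne_zero_of_log_eq_zero hs.1.1.le hs.2 h0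
          · linarith [hne x ⟨⟨hs.1.1.trans hx1, hx.2⟩, h0⟩ hx1, hx.2]
        -- Otherwise `-u / φ` increases from `0`, so `uφ < 0` at `γ`; with `uφ' = 1` this
        -- contradicts `φφ' ≥ 0`.
        have h2 := div_lt_div_of_wronskian_pos (f := fun x => -u x) (f' := fun x => -du x) hsγ
          h.continuous_log.neg.continuousOn h.continuous_reg.continuousOn
          (fun x hx => (h.hasDerivAt_log x (hs.1.1.trans hx.1)).neg)
          (fun x _ => h.hasDerivAt_reg x)
          (fun x hx => by
            have := h.wronskian x (hs.1.1.trans hx.1)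
            linarith) hφ
        rw [hs.2, neg_zero, zero_div, div_pos_iff] at h2
        rcases h2 with ⟨h2, h3⟩ | ⟨h2, h3⟩ <;> nlinarith
      · obtain ⟨c, hc, h0⟩ := h.exists_reg_eq_zero hs.1.1.le hst hs.2 ht.2
        exact ⟨c, ⟨⟨hs.1.1.trans hc.1, hc.2.le.trans ht.1.2⟩, h0⟩, hc⟩
    · refine le_antisymm ((h.encard_zerosIoc_reg_le γ).trans
        (encard_le_encard (zerosIoo_subset_zerosIoc dφ γ))) ?_
      refine encard_le_of_interleaved_right (b := γ + 1) (fun x hx => by linarith [hx.1.2])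
        (fun s hs => ?_) fun s hs t ht hst => ?_
      · by_contra! hne
        have hsγ : s < γ := lt_of_le_of_ne hs.1.2 fun h0 => hdγ (h0 ▸ hs.2)
        have hφ : ∀ x ∈ Icc s γ, φ x ≠ 0 := by
          intro x hx h0
          rcases hx.1.eq_or_lt with rfl | hx1
          · exact h.reg_ne_zero_of_dreg_eq_zero hs.1.1 hs.2 h0
          · linarith [hne x ⟨⟨hs.1.1.trans hx1, hx.2⟩, h0⟩ hx1, hx.2]
        -- The Riccati quotient `-φ' / φ` increases since its numerator Wronskian is `qφ² + φ'²`.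
        have h2 := div_lt_div_of_wronskian_pos (f := fun x => -dφ x) hsγ
          h.continuous_dreg.neg.continuousOn h.continuous_reg.continuousOn
          (fun x hx => (h.hasDerivAt_dreg x (hs.1.1.trans hx.1)).neg)
          (fun x _ => h.hasDerivAt_reg x)
          (fun x hx => by
            have h3 := h.coulombCoeff_pos_of_dreg_eq_zero hE' hs.1.1 hs.2 hx.1.le
            have h4 := hφ x (Ioo_subset_Icc_self hx)
            have h5 : 0 < coulombCoeff E x * φ x ^ 2 + dφ x ^ 2 := by positivity
            linarith) hφ
        rw [hs.2, neg_zero, zero_div, div_pos_iff] at h2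
        rcases h2 with ⟨h2, h3⟩ | ⟨h2, h3⟩ <;> nlinarith
      · obtain ⟨c, hc, h0⟩ := h.exists_reg_eq_zero_of_dreg hs.1.1 hst
          (fun r hr => h.coulombCoeff_pos_of_dreg_eq_zero hE' hs.1.1 hs.2 hr.1.le) hs.2 ht.2
        exact ⟨c, ⟨⟨hs.1.1.trans hc.1, hc.2.le.trans ht.1.2⟩, h0⟩, hc⟩

end IsFundamentalPair

/-! ### The interlaced sequence of zeros -/

/-- `x` is the `n`-th positive zero of `f`. -/
def IsNthZero (f : ℝ → ℝ) (n : ℕ) (x : ℝ) : Prop :=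
  0 < x ∧ f x = 0 ∧ (zerosIoc f x).encard = n

theorem encard_zerosIoc_add_one_le {f : ℝ → ℝ} {x y : ℝ} (hy : 0 < y) (hxy : x < y)
    (hf : f y = 0) : (zerosIoc f x).encard + 1 ≤ (zerosIoc f y).encard := by
  rw [← encard_insert_of_notMem (a := y) fun h => h.1.2.not_gt hxy]
  refine encard_le_encard (insert_subset ⟨⟨hy, le_rfl⟩, hf⟩ (zerosIoc_mono f hxy.le))

theorem IsNthZero.le {f : ℝ → ℝ} {n : ℕ} {x y : ℝ} (hx : IsNthZero f n x) (hy : IsNthZero f n y) :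
    y ≤ x := by
  by_contra! h
  have := encard_zerosIoc_add_one_le hy.1 h hy.2.1
  rw [hx.2.2, hy.2.2] at this
  norm_cast at this
  omega

theorem IsNthZero.sInf_eq {f : ℝ → ℝ} {n : ℕ} {x : ℝ} (hx : IsNthZero f n x) :
    sInf {y | IsNthZero f n y} = x := by
  have : {y | IsNthZero f n y} = {x} := by
    ext y
    exact ⟨fun hy => le_antisymm (hx.le hy) (hy.le hx), fun hy => hy ▸ hx⟩
  rw [this, csInf_singleton]

/-- The infimum of the empty set is `0`, so a positive value certifies that the zero exists. Hence
the infinitude of zeros need not be proved. -/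
theorem isNthZero_sInf {f : ℝ → ℝ} {n : ℕ} (h : 0 < sInf {y | IsNthZero f n y}) :
    IsNthZero f n (sInf {y | IsNthZero f n y}) := by
  rcases eq_empty_or_nonempty {y | IsNthZero f n y} with he | ⟨x, hx⟩
  · simp [he] at h
  · rwa [IsNthZero.sInf_eq hx]

theorem exists_isNthZero {f : ℝ → ℝ} {n : ℕ} {y : ℝ} (hn : 1 ≤ n)
    (hfin : (zerosIoc f y).Finite) (hle : (n : ℕ∞) ≤ (zerosIoc f y).encard) :
    ∃ x, IsNthZero f n x := by
  obtain ⟨s, hs⟩ := hfin.exists_finset_coe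
  rw [← hs, encard_coe_eq_coe_finsetCard] at hle
  have hle' : n ≤ s.card := by exact_mod_cast hle
  let e := s.orderEmbOfFin rfl
  let i : Fin s.card := ⟨n - 1, by omega⟩
  have hmem : ∀ j, e j ∈ zerosIoc f y := fun j => by
    rw [← hs]
    exact s.orderEmbOfFin_mem rfl j
  refine ⟨e i, (hmem i).1.1, (hmem i).2, ?_⟩
  have : zerosIoc f (e i) = ((Finset.Iic i).map e.toEmbedding : Finset ℝ) := by
    ext t
    rw [Finset.coe_map, Finset.coe_Iic]
    constructor
    · rintro ⟨ht, h0⟩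
      have h1 : t ∈ s := by
        rw [← Finset.mem_coe, hs]
        exact ⟨⟨ht.1, ht.2.trans (hmem i).1.2⟩, h0⟩
      rw [← Finset.mem_coe, ← s.range_orderEmbOfFin rfl] at h1
      obtain ⟨j, rfl⟩ := h1
      exact ⟨j, e.le_iff_le.mp ht.2, rfl⟩
    · rintro ⟨j, hj, rfl⟩
      exact ⟨⟨(hmem j).1.1, e.le_iff_le.mpr hj⟩, (hmem j).2⟩
  rw [this, encard_coe_eq_coe_finsetCard, Finset.card_map, Fin.card_Iic]
  norm_cast
  change n - 1 + 1 = n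
  omega

theorem nthPosRoot_eq {g : ℝ → ℂ} {f : ℝ → ℝ} (h : ∀ r, 0 < r → (g r = 0 ↔ f r = 0)) (n : ℕ) :
    nthPosRoot g n = sInf {x | IsNthZero f n x} := by
  rw [nthPosRoot]
  congr 1
  ext x
  have hz : {t : ℝ | t ∈ Ioc 0 x ∧ g t = 0} = zerosIoc f x := by
    ext t
    exact and_congr_right fun ht => h t ht.1
  simp only [mem_ofPred_eq, IsNthZero, hz]
  exact and_congr_right fun hx => and_congr_left fun _ => h x hx

/-- `0`, the first positive zero of `f'`, the first positive zero of `f`, and so on. -/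
noncomputable def zeroSeq (f f' : ℝ → ℝ) (n : ℕ) : ℝ :=
  if n = 0 then 0
  else if Even n then sInf {x | IsNthZero f (n / 2) x}
  else sInf {x | IsNthZero f' ((n + 1) / 2) x}

theorem whittakerSeq_eq {E : ℝ} (hE : |E| ≤ 1) (n : ℕ) :
    whittakerSeq (-(E * Complex.I)) n = zeroSeq (regSol E) (dregSol E) n := by
  rw [whittakerSeq, zeroSeq, nthPosRoot_eq (f := regSol E), nthPosRoot_eq (f := dregSol E)]
  · intro r hr
    rw [(whittakerM_half_I_mul hE hr).2, Complex.ofReal_eq_zero]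
  · intro r hr
    rw [(whittakerM_half_I_mul hE hr).1]
    simp

theorem zeroSeq_even (f f' : ℝ → ℝ) {m : ℕ} (hm : 1 ≤ m) :
    zeroSeq f f' (2 * m) = sInf {x | IsNthZero f m x} := by
  rw [zeroSeq, if_neg (by omega), if_pos (even_two_mul m), Nat.mul_div_cancel_left m two_pos]

theorem zeroSeq_odd (f f' : ℝ → ℝ) (m : ℕ) :
    zeroSeq f f' (2 * m + 1) = sInf {x | IsNthZero f' (m + 1) x} := by
  rw [zeroSeq, if_neg (by omega), if_neg (by simp), show (2 * m + 1 + 1) / 2 = m + 1 by omega]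

theorem encard_zerosIoc_ne_zero {f : ℝ → ℝ} {x : ℝ} (hx : 0 < x) (hf : f x = 0) :
    (zerosIoc f x).encard ≠ 0 :=
  encard_ne_zero.mpr ⟨x, ⟨hx, le_rfl⟩, hf⟩

namespace IsFundamentalPair

variable {E γ : ℝ} {φ dφ u du : ℝ → ℝ} (h : IsFundamentalPair E φ dφ u du)
include h

/-- The position of `γ` among the zeros determines how many zeros there are in `(0, γ]`. -/
theorem encard_zeros_of_mem_Ico (hE : E = 1 ∨ E = -1) (hγ : 0 < γ) {k : ℕ} (hk : 1 ≤ k)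
    (hmem : γ ∈ Ico (zeroSeq φ dφ (k - 1)) (zeroSeq φ dφ k)) :
    (zerosIoc φ γ).encard = ((k - 1) / 2 : ℕ) ∧ (zerosIoc dφ γ).encard = (k / 2 : ℕ) ∧
      (φ γ = 0 → Odd k ∧ γ = zeroSeq φ dφ (k - 1)) ∧
      (dφ γ = 0 → Even k ∧ γ = zeroSeq φ dφ (k - 1)) := by
  have hpos : 0 < zeroSeq φ dφ k := hγ.trans hmem.2
  have i1 : ∀ x, (zerosIoc φ x).encard ≤ (zerosIoc dφ x).encard := fun x =>
    (h.encard_zerosIoc_reg_le x).trans (encard_le_encard (zerosIoo_subset_zerosIoc dφ x))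
  have i2 : ∀ x, (zerosIoc dφ x).encard ≤ (zerosIoc φ x).encard + 1 := fun x =>
    (h.encard_zerosIoc_dreg_le hE x).trans
      (add_le_add_left (encard_le_encard (zerosIoo_subset_zerosIoc φ x)) 1)
  -- If `γ` is itself a zero, the interlacing bound sharpens by one; `i3` and `i4` exclude the zero
  -- of the wrong parity.
  have i3 : φ γ = 0 → (zerosIoc dφ γ).encard ≤ (zerosIoc φ γ).encard := fun h0 => by
    rw [encard_zerosIoc_of_eq_zero hγ h0]
    exact h.encard_zerosIoc_dreg_le hE γ
  have i4 : dφ γ = 0 → (zerosIoc φ γ).encard + 1 ≤ (zerosIoc dφ γ).encard := fun h0 => by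
    rw [encard_zerosIoc_of_eq_zero hγ h0]
    exact add_le_add_left (h.encard_zerosIoc_reg_le γ) 1
  rcases Nat.even_or_odd' k with ⟨m, rfl | rfl⟩
  · have hm : 1 ≤ m := by omega
    obtain ⟨l, rfl⟩ : ∃ l, m = l + 1 := ⟨m - 1, by omega⟩
    rw [zeroSeq_even φ dφ hm] at hmem hpos
    have hprev : 2 * (l + 1) - 1 = 2 * l + 1 := by omega
    rw [hprev, zeroSeq_odd] at hmem ⊢
    have hx := isNthZero_sInf hpos
    set x := sInf {x | IsNthZero φ (l + 1) x}
    have a1 := encard_zerosIoc_add_one_le hx.1 hmem.2 hx.2.1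
    have a2 := i2 x
    have a3 := i1 x
    rw [hx.2.2] at a1 a2 a3
    have hfin : (zerosIoc dφ x).Finite := by
      refine finite_of_encard_le_coe (k := l + 1 + 1) ?_
      exact_mod_cast a2
    -- The upper end exists because it is positive; interlacing up to it supplies the lower end `y`.
    obtain ⟨y, hy⟩ := exists_isNthZero hm hfin a3
    rw [hy.sInf_eq] at hmem ⊢
    have a4 := encard_le_encard (zerosIoc_mono dφ hmem.1)
    rw [hy.2.2] at a4
    have a5 := i2 γ
    have e0 : (zerosIoc φ γ).encard = l := by
      have a6 := a4.trans a5
      push_cast at a1 a6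
      exact le_antisymm ((ENat.add_le_add_iff_right ENat.one_ne_top).mp a1)
        ((ENat.add_le_add_iff_right ENat.one_ne_top).mp a6)
    have e1 : (zerosIoc dφ γ).encard = (l + 1 : ℕ) := by
      refine le_antisymm ?_ a4
      rw [e0] at a5
      exact_mod_cast a5
    refine ⟨by rw [e0]; congr 1; omega, by rw [e1]; congr 1; omega, fun h0 => ?_, fun h0 => ?_⟩
    · have := i3 h0
      rw [e0, e1] at this
      norm_cast at this
      omega
    · exact ⟨even_two_mul _, le_antisymm (hy.le ⟨hγ, h0, e1⟩) hmem.1⟩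
  · rw [zeroSeq_odd] at hmem hpos
    rw [Nat.add_sub_cancel] at hmem ⊢
    have hx := isNthZero_sInf hpos
    set x := sInf {x | IsNthZero dφ (m + 1) x}
    have a1 := encard_zerosIoc_add_one_le hx.1 hmem.2 hx.2.1
    have a2 := i2 x
    have a3 := i1 x
    rw [hx.2.2] at a1 a2 a3
    have a6 : (zerosIoc dφ γ).encard ≤ m := by
      refine (ENat.add_le_add_iff_right ENat.one_ne_top).mp (a1.trans ?_)
      exact_mod_cast le_rfl
    have a5 := i1 γ
    have d1 : (2 * m) / 2 = m := by omega
    have d2 : (2 * m + 1) / 2 = m := by omega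
    rw [d1, d2]
    -- For `m = 0` the lower end is the conventional `0`, which is not a counted zero.
    rcases Nat.eq_zero_or_pos m with rfl | hm
    · have e1 : (zerosIoc dφ γ).encard = 0 := by simpa using a6
      have e0 : (zerosIoc φ γ).encard = 0 := by simpa [e1] using a5
      exact ⟨by simpa using e0, by simpa using e1,
        fun h0 => absurd e0 (encard_zerosIoc_ne_zero hγ h0),
        fun h0 => absurd e1 (encard_zerosIoc_ne_zero hγ h0)⟩
    · rw [zeroSeq_even φ dφ hm] at hmem ⊢
      have hfin : (zerosIoc φ x).Finite := finite_of_encard_le_coe a3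
      have a7 : (m : ℕ∞) ≤ (zerosIoc φ x).encard := by
        refine (ENat.add_le_add_iff_right ENat.one_ne_top).mp (a2.trans' ?_)
        exact_mod_cast le_rfl
      obtain ⟨y, hy⟩ := exists_isNthZero hm hfin a7
      rw [hy.sInf_eq] at hmem ⊢
      have a4 := encard_le_encard (zerosIoc_mono φ hmem.1)
      rw [hy.2.2] at a4
      have e0 : (zerosIoc φ γ).encard = m := le_antisymm (a5.trans a6) a4
      have e1 : (zerosIoc dφ γ).encard = m := le_antisymm a6 (a4.trans a5)
      refine ⟨e0, e1, fun h0 => ?_, fun h0 => ?_⟩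
      · exact ⟨odd_two_mul_add_one m, le_antisymm (hy.le ⟨hγ, h0, e0⟩) hmem.1⟩
      · have := i4 h0
        rw [e0, e1] at this
        norm_cast at this
        omega

/-- A solution on `(0, γ]` is the restriction of a global one. -/
theorem exists_isFundamentalPair {w : ℝ → ℝ} (hγ : 0 < γ) (hw : IsNormalizedSolution E γ w) :
    ∃ v dv : ℝ → ℝ, IsFundamentalPair E φ dφ v dv ∧ EqOn w v (Icc 0 γ) ∧
      EqOn (dotOn γ w) dv (Ioc 0 γ) := by
  obtain ⟨β, h1, h2⟩ := h.eqOn_of_isNormalizedSolution hγ hw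
  exact ⟨_, _, h.add_mul_reg β, h1, h2⟩

end IsFundamentalPair

/-! ### Translation to the boundary value problems -/

theorem criticalPoints_eq {γ : ℝ} {w dv : ℝ → ℝ} (h : EqOn (dotOn γ w) dv (Ioc 0 γ)) :
    criticalPoints γ w = zerosIoc dv γ := by
  ext t
  exact and_congr_right fun ht => by rw [h ht]

theorem roots_eq {γ : ℝ} {w v : ℝ → ℝ} (h0 : w 0 ≠ 0) (h : EqOn w v (Icc 0 γ)) :
    roots γ w = zerosIoc v γ := by
  ext t
  constructor
  · rintro ⟨ht, h1⟩
    exact ⟨⟨lt_of_le_of_ne ht.1 fun h2 => h0 (h2 ▸ h1), ht.2⟩, by rw [← h ht, h1]⟩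
  · rintro ⟨ht, h1⟩
    have ht' := Ioc_subset_Icc_self ht
    exact ⟨ht', by rw [h ht', h1]⟩

theorem floor_half_add_one (k : ℕ) : ⌊(k : ℝ) / 2 + 1⌋₊ = k / 2 + 1 := by
  rw [Nat.floor_add_one (by positivity)]
  congr 1
  exact_mod_cast Nat.floor_div_eq_div (K := ℝ) k 2

theorem floor_half (k : ℕ) : ⌊(k : ℝ) / 2⌋₊ = k / 2 := by
  exact_mod_cast Nat.floor_div_eq_div (K := ℝ) k 2

theorem floor_half_add_half {k : ℕ} (hk : 1 ≤ k) : ⌊(k : ℝ) / 2 + 1 / 2⌋₊ = (k - 1) / 2 + 1 := by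
  rw [← add_div, ← Nat.cast_add_one, floor_half]
  omega

theorem gammaSeq_eq (n : ℕ) : gammaSeq n = zeroSeq (regSol 1) (dregSol 1) n := by
  rw [← whittakerSeq_eq (by simp), gammaSeq]
  simp

theorem GammaSeq_eq (n : ℕ) : GammaSeq n = zeroSeq (regSol (-1)) (dregSol (-1)) n := by
  rw [← whittakerSeq_eq (by simp), GammaSeq]
  simp

theorem mainTheorem8 (γ : ℝ) (hγ : 0 < γ) (k j : ℕ) (hk : 1 ≤ k) (hj : 1 ≤ j)
    (hγk : γ ∈ Set.Ico (gammaSeq (k - 1)) (gammaSeq k))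
    (hγj : γ ∈ Set.Ico (GammaSeq (j - 1)) (GammaSeq j)) :
    -- `E = 1`, odd problem
    ((¬ (Even k ∧ γ = gammaSeq (k - 1)) → HasUniqueSolution γ (SolvesOddBVP 1 γ)) ∧
      ∀ w : ℝ → ℝ, SolvesOddBVP 1 γ w →
        (criticalPoints γ w).encard = (⌊(k : ℝ) / 2 + 1⌋₊ : ℕ∞)) ∧
    -- `E = 1`, even problem
    ((¬ (Odd k ∧ γ = gammaSeq (k - 1)) → HasUniqueSolution γ (SolvesEvenBVP 1 γ)) ∧
      ∀ w : ℝ → ℝ, SolvesEvenBVP 1 γ w →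
        (criticalPoints γ w).encard = (⌊(k : ℝ) / 2 + 1 / 2⌋₊ : ℕ∞)) ∧
    -- `E = -1`, odd problem
    ((¬ (Even j ∧ γ = GammaSeq (j - 1)) → HasUniqueSolution γ (SolvesOddBVP (-1) γ)) ∧
      ∀ w : ℝ → ℝ, SolvesOddBVP (-1) γ w →
        (roots γ w).encard = (⌊(j : ℝ) / 2⌋₊ : ℕ∞)) ∧
    -- `E = -1`, even problem
    ((¬ (Odd j ∧ γ = GammaSeq (j - 1)) → HasUniqueSolution γ (SolvesEvenBVP (-1) γ)) ∧
      ∀ w : ℝ → ℝ, SolvesEvenBVP (-1) γ w →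
        (roots γ w).encard = (⌊(j : ℝ) / 2 + 1 / 2⌋₊ : ℕ∞)) := by
  have hp := isFundamentalPair_logSol (E := 1) (by simp)
  have hn := isFundamentalPair_logSol (E := -1) (by simp)
  rw [gammaSeq_eq, gammaSeq_eq] at hγk
  rw [GammaSeq_eq, GammaSeq_eq] at hγj
  obtain ⟨p0, p1, p2, p3⟩ := hp.encard_zeros_of_mem_Ico (Or.inl rfl) hγ hk hγk
  obtain ⟨n0, n1, n2, n3⟩ := hn.encard_zeros_of_mem_Ico (Or.inr rfl) hγ hj hγj
  have hIoc : γ ∈ Ioc 0 γ := ⟨hγ, le_rfl⟩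
  have hIcc : γ ∈ Icc 0 γ := ⟨hγ.le, le_rfl⟩
  rw [gammaSeq_eq, GammaSeq_eq]
  refine ⟨⟨fun hne => hp.hasUniqueSolution_odd hγ fun h0 => hne (p3 h0), fun w hw => ?_⟩,
    ⟨fun hne => hp.hasUniqueSolution_even hγ fun h0 => hne (p2 h0), fun w hw => ?_⟩,
    ⟨fun hne => hn.hasUniqueSolution_odd hγ fun h0 => hne (n3 h0), fun w hw => ?_⟩,
    ⟨fun hne => hn.hasUniqueSolution_even hγ fun h0 => hne (n2 h0), fun w hw => ?_⟩⟩
  · obtain ⟨v, dv, hv, -, h2⟩ := hp.exists_isFundamentalPair hγ hw.1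
    rw [criticalPoints_eq h2, hv.encard_zerosIoc_dlog_of_eq_zero one_pos hγ (by rw [← h2 hIoc, hw.2]),
      p1, floor_half_add_one]
    norm_cast
  · obtain ⟨v, dv, hv, h1, h2⟩ := hp.exists_isFundamentalPair hγ hw.1
    rw [criticalPoints_eq h2,
      hv.encard_zerosIoc_dlog_of_log_eq_zero one_pos hγ (by rw [← h1 hIcc, hw.2]), p0,
      floor_half_add_half hk]
    norm_cast
  · obtain ⟨v, dv, hv, h1, h2⟩ := hn.exists_isFundamentalPair hγ hw.1
    rw [roots_eq (by simp [hw.1.left_bc]) h1,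
      hv.encard_zerosIoc_log_of_dlog_eq_zero rfl hγ (by rw [← h2 hIoc, hw.2]), n1, floor_half]
  · obtain ⟨v, dv, hv, h1, -⟩ := hn.exists_isFundamentalPair hγ hw.1
    rw [roots_eq (by simp [hw.1.left_bc]) h1,
      hv.encard_zerosIoc_log_of_eq_zero hγ (by rw [← h1 hIcc, hw.2]), n0, floor_half_add_half hj]
    norm_cast
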